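/- Let $n$ be a positive integer. **Diagrams.** An $n$-diagram $d$ is a partition of the $2n$ vertices $1,\dots,n$ (on the northern edge of a rectangle, from left to right) and $1',\dots,n'$ (on the southern edge, from left to right) into blocks of size two that can be joined by non-intersecting arcs inside the rectangle. The product rule is $D_1D_2=\delta^L D_3$: stack $D_1$ on top of $D_2$, identifying the southern vertices of $D_1$ with the northern vertices of $D_2$; $L$ is the number of closed loops, and $D_3$ is the diagram left after removing the middle vertices and loops ($\delta$ is a formal parameter). For $1\le i\le n-1$ let $e_i$ be the diagram with blocks $\{i,i+1\}$, $\{i',(i+1)'\}$ and $\{j,j'\}$ for $j\neq i,i+1$; the empty word stands for the diagram with blocks $\{j,j'\}$ for all $j$. A word in $e_1,\dots,e_{n-1}$ is a *reduced expression* of $d$ if its product is $d$ and it is as short as any word whose product is $d$ up to a power of $\delta$. A *Jones normal form* of $d$ is a reduced expression of $d$ of the form $$(e_{j_1}e_{j_1-1}\cdots e_{k_1})(e_{j_2}e_{j_2-1}\cdots e_{k_2})\cdots(e_{j_r}e_{j_r-1}\cdots e_{k_r}),$$ with $r\ge 0$, $0<j_1<\dots<j_r<n$, $0<k_1<\dots<k_r<n$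 and $j_i\ge k_i$ for all $i$. A *dual Jones normal form* of $d$ is a reduced expression of $d$ of the form $$(e_{k_1}e_{k_1+1}\cdots e_{j_1})(e_{k_2}e_{k_2+1}\cdots e_{j_2})\cdots(e_{k_r}e_{k_r+1}\cdots e_{j_r}),$$ with $r\ge 0$, $n>j_1>\dots>j_r>0$, $n>k_1>\dots>k_r>0$ and $k_i\le j_i$ for all $i$. **Labeled skew shapes.** Use coordinates on $\mathbb R^2$ in which $(x,y)$ is $x$ units south and $y$ units east of the origin, and identify a unit box with integral corners with its southeastern corner $(i,j)\in\mathbb Z\times\mathbb Z$. A *labeled skew shape* is a set of boxes obtained by placing a skew shape $\lambda\setminus\mu$ (for partitions $\mu\subset\lambda$, drawn in English notation) on the integer grid, with the box $(i,j)$ labeled by $i-j$, all labels being positive. Two labeled skew shapes are *BJS-equivalent* if there is a bijection between their sets of boxes that preserves the labels and preserves the order induced by the product order of $\mathbb Z\times\mathbb Z$. The *row reading word* of a labeled skew shape is $e_{a_1}e_{a_2}\cdots$, where $a_1,a_2,\dots$ are its labels read row by row from top to bottom, each row from left to right. The *column reading word* is obtained in the same way by reading column by column from left to right, each column from top to bottom.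 **Bowman's algorithm.** Given an $n$-diagram $d$, put $\xi(k)=W$ if the vertex $k$ is connected to a vertex strictly to its right and $\xi(k)=S$ otherwise; put $\xi(k')=N$ if the vertex $k'$ is connected to a vertex weakly to its right and $\xi(k')=E$ otherwise. Start at $(0,0)$ and move successively one unit in the compass directions $\xi(1),\dots,\xi(n),\xi(n'),\dots,\xi(1')$. Discard the unit segments that are traversed twice, and let $\Theta(d)$ be the set of boxes enclosed by the remaining segments, the box $(i,j)$ being labeled by $i-j$. **Theorem.** For every $n$-diagram $d$, $\Theta(d)$ is a labeled skew shape with all labels less than $n$. Moreover: (a) $\Theta$ induces a bijection from the set of $n$-diagrams to the set of BJS-equivalence classes of labeled skew shapes with all labels less than $n$. (b) For every $n$-diagram $d$, the row reading word of $\Theta(d)$ is the unique Jones normal form of $d$, and the column reading word of $\Theta(d)$ is the unique dual Jones normal form of $d$. -/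

import Mathlib

/-! ## Planar diagrams -/

/-- The vertices of an `n`-diagram: `Sum.inl i` is the northern vertex `i + 1`, and
`Sum.inr i` is the southern vertex `(i + 1)'`. -/
abbrev DVertex (n : ℕ) : Type := Fin n ⊕ Fin n

/-- The horizontal position (column) of a vertex. -/
def DVertex.col {n : ℕ} : DVertex n → Fin n
  | Sum.inl i => i
  | Sum.inr i => i

/-- The position of a vertex in the clockwise order `1, …, n, n', …, 1'`. -/
def DVertex.clockwise {n : ℕ} : DVertex n → ℕ
  | Sum.inl i => i
  | Sum.inr i => 2 * n - 1 - i

/-- An `n`-diagram: a partition of the `2n` boundary vertices of a rectangle into blocks of size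
two (`partner` sends a vertex to the other element of its block) such that the blocks can be joined
by non-intersecting arcs inside the rectangle, i.e. no two blocks interlace in the clockwise
order. -/
structure PlanarDiagram (n : ℕ) where
  partner : DVertex n → DVertex n
  partner_partner : ∀ x, partner (partner x) = x
  partner_ne : ∀ x, partner x ≠ x
  planar : ∀ x y, ¬ (DVertex.clockwise x < DVertex.clockwise y ∧
    DVertex.clockwise y < DVertex.clockwise (partner x) ∧
    DVertex.clockwise (partner x) < DVertex.clockwise (partner y))

/-- The identity diagram, with blocks `{i, i'}`. -/
def idDiagram (n : ℕ) : PlanarDiagram n where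
  partner := fun x => match x with
    | Sum.inl k => Sum.inr k
    | Sum.inr k => Sum.inl k
  partner_partner := by rintro (x | x) <;> rfl
  partner_ne := by rintro (x | x) <;> simp
  planar := by
    rintro (x | x) (y | y) <;> simp only [DVertex.clockwise] <;> omega

/-- The diagram `ê_i` for `1 ≤ i ≤ n - 1`, with blocks `{i, i+1}`, `{i', (i+1)'}` and `{j, j'}` for
`j ≠ i, i + 1`. -/
def genDiagram (n i : ℕ) (hi : 0 < i) (hin : i < n) : PlanarDiagram n where
  partner := fun x => match x with
    | Sum.inl k =>
        if (k : ℕ) + 1 = i then Sum.inl ⟨i, hin⟩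
        else if (k : ℕ) = i then Sum.inl ⟨i - 1, by omega⟩ else Sum.inr k
    | Sum.inr k =>
        if (k : ℕ) + 1 = i then Sum.inr ⟨i, hin⟩
        else if (k : ℕ) = i then Sum.inr ⟨i - 1, by omega⟩ else Sum.inl k
  partner_partner := by
    have h1 : i - 1 + 1 = i := by omega
    have h2 : i + 1 ≠ i := by omega
    rintro (⟨k, hk⟩ | ⟨k, hk⟩)
    all_goals
      by_cases h : k + 1 = i
      · subst h; simp
      · by_cases h' : k = i
        · subst h'; simp [h1]
        · simp [h, h']
  partner_ne := by
    rintro (k | k) <;> dsimp only <;> split_ifs <;> simp [Fin.ext_iff] <;> omega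
  planar := by
    rintro (x | x) (y | y) <;> dsimp only <;> split_ifs <;>
      simp only [DVertex.clockwise] <;> omega

/-! ## Multiplication of diagrams -/

/-- The vertices of two stacked diagrams: northern, middle and southern vertices. -/
abbrev StackVertex (n : ℕ) : Type := Fin n ⊕ (Fin n ⊕ Fin n)

/-- Vertices of the upper diagram in the stack; its southern vertices are the middle vertices. -/
def upperVertex {n : ℕ} : DVertex n → StackVertex n
  | Sum.inl i => Sum.inl i
  | Sum.inr i => Sum.inr (Sum.inl i)

/-- Vertices of the lower diagram in the stack; its northern vertices are the middle vertices. -/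
def lowerVertex {n : ℕ} : DVertex n → StackVertex n
  | Sum.inl i => Sum.inr (Sum.inl i)
  | Sum.inr i => Sum.inr (Sum.inr i)

/-- The vertices of the stack which remain when the middle line is removed. -/
def outerVertex {n : ℕ} : DVertex n → StackVertex n
  | Sum.inl i => Sum.inl i
  | Sum.inr i => Sum.inr (Sum.inr i)

/-- The graph obtained by stacking `D₁` on top of `D₂`. -/
def stackGraph {n : ℕ} (D₁ D₂ : PlanarDiagram n) : SimpleGraph (StackVertex n) :=
  SimpleGraph.fromRel fun u v =>
    (∃ x, u = upperVertex x ∧ v = upperVertex (D₁.partner x)) ∨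
    (∃ x, u = lowerVertex x ∧ v = lowerVertex (D₂.partner x))

/-- The number of loops of the stack: of connected components with middle vertices only. -/
noncomputable def loopCount {n : ℕ} (D₁ D₂ : PlanarDiagram n) : ℕ :=
  Set.ncard {c : (stackGraph D₁ D₂).ConnectedComponent |
    ∀ x : DVertex n, (stackGraph D₁ D₂).connectedComponentMk (outerVertex x) ≠ c}

/-- `IsProduct D₁ D₂ L D₃` is the multiplication rule `D₁ D₂ = δ ^ L D₃`: stacking `D₁` on top of
`D₂` produces `L` loops, and removing the middle data leaves `D₃`. -/
def IsProduct {n : ℕ} (D₁ D₂ : PlanarDiagram n) (L : ℕ) (D₃ : PlanarDiagram n) : Prop :=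
  L = loopCount D₁ D₂ ∧
  ∀ x y : DVertex n, x ≠ y →
    (D₃.partner x = y ↔ (stackGraph D₁ D₂).Reachable (outerVertex x) (outerVertex y))

/-- `WordProduct w L D`: all letters of `w = i₁ ⋯ i_l` lie in `{1, …, n - 1}`, and
`ê_{i₁} ⋯ ê_{i_l} = δ ^ L D`. -/
inductive WordProduct {n : ℕ} : List ℕ → ℕ → PlanarDiagram n → Prop
  | nil : WordProduct [] 0 (idDiagram n)
  | cons {i : ℕ} {w : List ℕ} {L M : ℕ} {D E : PlanarDiagram n} (hi : 0 < i) (hin : i < n) :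
      WordProduct w L D → IsProduct (genDiagram n i hi hin) D M E → WordProduct (i :: w) (M + L) E

/-- `w` is a reduced expression of `d`: the product of `w` is `d`, and `w` is as short as any word
whose product is `d` up to a power of `δ`. -/
def IsReducedExpression {n : ℕ} (w : List ℕ) (d : PlanarDiagram n) : Prop :=
  WordProduct w 0 d ∧ ∀ (v : List ℕ) (L : ℕ), WordProduct v L d → w.length ≤ v.length

/-- The decreasing run `j, j - 1, …, k`. -/
def descRun (j k : ℕ) : List ℕ := (List.range' k (j + 1 - k)).reverse

/-- The increasing run `k, k + 1, …, j`. -/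
def ascRun (k j : ℕ) : List ℕ := List.range' k (j + 1 - k)

/-- `w` has the shape `(j₁ ⋯ k₁)(j₂ ⋯ k₂) ⋯ (j_r ⋯ k_r)` with decreasing runs such that
`0 < j₁ < ⋯ < j_r < n`, `0 < k₁ < ⋯ < k_r < n` and `j_i ≥ k_i` for all `i`. -/
def HasJonesShape (n : ℕ) (w : List ℕ) : Prop :=
  ∃ jk : List (ℕ × ℕ),
    w = jk.flatMap (fun p => descRun p.1 p.2) ∧
    (∀ p ∈ jk, 0 < p.1 ∧ p.1 < n ∧ 0 < p.2 ∧ p.2 < n ∧ p.2 ≤ p.1) ∧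
    jk.Pairwise (fun p q => p.1 < q.1 ∧ p.2 < q.2)

/-- The dual shape `(k₁ ⋯ j₁)(k₂ ⋯ j₂) ⋯ (k_r ⋯ j_r)` with increasing runs such that
`n > j₁ > ⋯ > j_r > 0`, `n > k₁ > ⋯ > k_r > 0` and `k_i ≤ j_i` for all `i`. -/
def HasDualJonesShape (n : ℕ) (w : List ℕ) : Prop :=
  ∃ kj : List (ℕ × ℕ),
    w = kj.flatMap (fun p => ascRun p.1 p.2) ∧
    (∀ p ∈ kj, 0 < p.1 ∧ p.1 < n ∧ 0 < p.2 ∧ p.2 < n ∧ p.1 ≤ p.2) ∧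
    kj.Pairwise (fun p q => p.1 > q.1 ∧ p.2 > q.2)

/-- `w` is a Jones normal form of the diagram `d`. -/
def IsJonesNormalForm {n : ℕ} (w : List ℕ) (d : PlanarDiagram n) : Prop :=
  IsReducedExpression w d ∧ HasJonesShape n w

/-- `w` is a dual Jones normal form of the diagram `d`. -/
def IsDualJonesNormalForm {n : ℕ} (w : List ℕ) (d : PlanarDiagram n) : Prop :=
  IsReducedExpression w d ∧ HasDualJonesShape n w

/-! ## Labeled skew shapes -/

/-- The label of the unit box whose southeastern corner is `b = (i, j)`, i.e. the point `i` units
south and `j` units east of the origin. -/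
def boxLabel (b : ℤ × ℤ) : ℤ := b.1 - b.2

/-- A labeled skew shape `(lam \ mu, ω)`: the difference of two Young diagrams `mu ⊆ lam`, placed
anywhere on the integer grid, each box being identified with its southeastern corner `(i, j)`, and
filled with `ω (i, j) = i - j`; the labels are positive integers. -/
structure LabeledSkewShape where
  boxes : Finset (ℤ × ℤ)
  isSkew : ∃ (lam mu : YoungDiagram) (a b : ℤ), mu ≤ lam ∧
    boxes = (lam.cells \ mu.cells).image (fun c => (a + (c.1 : ℤ), b + (c.2 : ℤ)))
  label_pos : ∀ b ∈ boxes, 0 < boxLabel b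

/-- BJS-equivalence: there is a label-preserving and order-preserving bijection between the sets of
boxes, for the product order of `ℤ × ℤ`. -/
def BJSEquiv (S T : LabeledSkewShape) : Prop :=
  ∃ f : S.boxes → T.boxes, Function.Bijective f ∧ Monotone f ∧
    ∀ b : S.boxes, boxLabel (f b : ℤ × ℤ) = boxLabel (b : ℤ × ℤ)

theorem LabeledSkewShape.convex (S : LabeledSkewShape) {x y z : ℤ × ℤ} (hx : x ∈ S.boxes)
    (hz : z ∈ S.boxes) (hxy : x ≤ y) (hyz : y ≤ z) : y ∈ S.boxes := by
  obtain ⟨lam, mu, a, b, -, h⟩ := S.isSkew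
  rw [h] at hx hz ⊢
  simp only [Finset.mem_image, Finset.mem_sdiff] at hx hz ⊢
  obtain ⟨⟨p, q⟩, ⟨hp1, hp2⟩, rfl⟩ := hx
  obtain ⟨⟨r, s⟩, ⟨hr1, hr2⟩, rfl⟩ := hz
  obtain ⟨y1, y2⟩ := y
  simp only [Prod.mk_le_mk] at hxy hyz
  have h1 : ((y1 - a).toNat : ℤ) = y1 - a := Int.toNat_of_nonneg (by omega)
  have h2 : ((y2 - b).toNat : ℤ) = y2 - b := Int.toNat_of_nonneg (by omega)
  refine ⟨((y1 - a).toNat, (y2 - b).toNat), ⟨?_, ?_⟩, ?_⟩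
  · exact lam.isLowerSet (a := (r, s)) (by rw [Prod.mk_le_mk]; omega) hr1
  · intro hm
    exact hp2 (mu.isLowerSet (b := (p, q)) (by rw [Prod.mk_le_mk]; omega) hm)
  · ext <;> simp <;> omega

theorem BJSEquiv.refl (S : LabeledSkewShape) : BJSEquiv S S :=
  ⟨id, Function.bijective_id, monotone_id, fun _ => rfl⟩

theorem BJSEquiv.trans {S T U : LabeledSkewShape} (h : BJSEquiv S T) (h' : BJSEquiv T U) :
    BJSEquiv S U := by
  obtain ⟨f, hf, mf, lf⟩ := h
  obtain ⟨g, hg, mg, lg⟩ := h'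
  exact ⟨g ∘ f, hg.comp hf, mg.comp mf, fun b => (lg (f b)).trans (lf b)⟩

theorem BJSEquiv.symm {S T : LabeledSkewShape} (h : BJSEquiv S T) : BJSEquiv T S := by
  obtain ⟨f, hf, mf, lf⟩ := h
  let e := Equiv.ofBijective f hf
  have le : ∀ b : T.boxes, boxLabel (e.symm b : ℤ × ℤ) = boxLabel (b : ℤ × ℤ) := by
    intro b
    have h := lf (e.symm b)
    have h' : f (e.symm b) = b := e.apply_symm_apply b
    rw [h'] at h
    exact h.symm
  -- boxes whose labels differ by one are comparable
  have cover : ∀ x y : T.boxes, x ≤ y →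
      (boxLabel (y : ℤ × ℤ) = boxLabel (x : ℤ × ℤ) + 1 ∨
        boxLabel (y : ℤ × ℤ) = boxLabel (x : ℤ × ℤ) - 1) → e.symm x ≤ e.symm y := by
    intro x y hxy hl
    have hc : e.symm x ≤ e.symm y ∨ e.symm y ≤ e.symm x := by
      have h1 := le x
      have h2 := le y
      rw [← h1, ← h2] at hl
      revert hl
      generalize e.symm x = u
      generalize e.symm y = v
      intro hl
      obtain ⟨⟨u1, u2⟩, hu⟩ := u
      obtain ⟨⟨v1, v2⟩, hv⟩ := v
      simp only [boxLabel, Subtype.mk_le_mk, Prod.mk_le_mk] at hl ⊢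
      omega
    rcases hc with hc | hc
    · exact hc
    · have h3 : f (e.symm y) ≤ f (e.symm x) := mf hc
      have h4 : f (e.symm x) = x := e.apply_symm_apply x
      have h5 : f (e.symm y) = y := e.apply_symm_apply y
      rw [h4, h5] at h3
      rw [_root_.le_antisymm hxy h3]
  have main : ∀ (m : ℕ) (x y : T.boxes), x ≤ y →
      ((y : ℤ × ℤ).1 - (x : ℤ × ℤ).1) + ((y : ℤ × ℤ).2 - (x : ℤ × ℤ).2) = m →
      e.symm x ≤ e.symm y := by
    intro m
    induction m with
    | zero =>
      rintro ⟨⟨x1, x2⟩, hx⟩ ⟨⟨y1, y2⟩, hy⟩ hxy hm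
      have hxy' := hxy
      simp only [Subtype.mk_le_mk, Prod.mk_le_mk] at hxy' hm
      obtain rfl : x1 = y1 := by push_cast at hm; omega
      obtain rfl : x2 = y2 := by push_cast at hm; omega
      exact le_rfl
    | succ m ih =>
      rintro ⟨⟨x1, x2⟩, hx⟩ ⟨⟨y1, y2⟩, hy⟩ hxy hm
      have hxy' := hxy
      simp only [Subtype.mk_le_mk, Prod.mk_le_mk] at hxy' hm
      by_cases h1 : x1 < y1
      · have hz : ((x1 + 1, x2) : ℤ × ℤ) ∈ T.boxes :=
          T.convex hx hy (by rw [Prod.mk_le_mk]; omega) (by rw [Prod.mk_le_mk]; omega)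
        refine _root_.le_trans (cover _ ⟨_, hz⟩ ?_ ?_) (ih ⟨_, hz⟩ _ ?_ ?_)
        · simp
        · left; simp only [boxLabel]; omega
        · simp only [Subtype.mk_le_mk, Prod.mk_le_mk]; omega
        · push_cast at hm ⊢; omega
      · have hz : ((x1, x2 + 1) : ℤ × ℤ) ∈ T.boxes :=
          T.convex hx hy (by rw [Prod.mk_le_mk]; omega)
            (by rw [Prod.mk_le_mk]; push_cast at hm; omega)
        refine _root_.le_trans (cover _ ⟨_, hz⟩ ?_ ?_) (ih ⟨_, hz⟩ _ ?_ ?_)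
        · simp
        · right; simp only [boxLabel]; omega
        · simp only [Subtype.mk_le_mk, Prod.mk_le_mk]; push_cast at hm; omega
        · push_cast at hm ⊢; omega
  refine ⟨e.symm, e.symm.bijective, ?_, le⟩
  intro x y hxy
  refine main (((y : ℤ × ℤ).1 - (x : ℤ × ℤ).1) +
    ((y : ℤ × ℤ).2 - (x : ℤ × ℤ).2)).toNat x y hxy ?_
  have h1 : (x : ℤ × ℤ).1 ≤ (y : ℤ × ℤ).1 := hxy.1
  have h2 : (x : ℤ × ℤ).2 ≤ (y : ℤ × ℤ).2 := hxy.2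
  omega

/-- Labeled skew shapes all of whose labels are less than `n`. -/
abbrev BoundedSkewShape (n : ℕ) : Type :=
  {S : LabeledSkewShape // ∀ b ∈ S.boxes, boxLabel b < n}

/-- BJS-equivalence on the labeled skew shapes with labels less than `n`. -/
def bjsSetoid (n : ℕ) : Setoid (BoundedSkewShape n) where
  r S T := BJSEquiv S.1 T.1
  iseqv := ⟨fun S => BJSEquiv.refl S.1, fun h => h.symm, fun h h' => h.trans h'⟩

/-- The row reading word: rows from top to bottom, each row from left to right. -/
def LabeledSkewShape.rowWord (S : LabeledSkewShape) : List ℕ :=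
  ((S.boxes.image (fun b => toLex (b.1, b.2))).sort (· ≤ ·)).map
    (fun c => (boxLabel ((ofLex c).1, (ofLex c).2)).toNat)

/-- The column reading word: columns from left to right, each column from top to bottom. -/
def LabeledSkewShape.colWord (S : LabeledSkewShape) : List ℕ :=
  ((S.boxes.image (fun b => toLex (b.2, b.1))).sort (· ≤ ·)).map
    (fun c => (boxLabel ((ofLex c).2, (ofLex c).1)).toNat)

/-! ## Bowman's algorithm -/

inductive Compass
  | N | S | E | W

/-- Unit steps, in coordinates whose positive directions are south and east. -/
def Compass.step : Compass → ℤ × ℤ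
  | N => (-1, 0)
  | S => (1, 0)
  | E => (0, 1)
  | W => (0, -1)

/-- The compass direction attached to a vertex of `d`. -/
def xi {n : ℕ} (d : PlanarDiagram n) : DVertex n → Compass
  | Sum.inl k => if k < DVertex.col (d.partner (Sum.inl k)) then Compass.W else Compass.S
  | Sum.inr k => if k ≤ DVertex.col (d.partner (Sum.inr k)) then Compass.N else Compass.E

/-- The vector `(ξ(1), …, ξ(n), ξ(n'), …, ξ(1'))`. -/
def xiVector {n : ℕ} (d : PlanarDiagram n) : List Compass :=
  (List.finRange n).map (fun k => xi d (Sum.inl k)) ++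
    (List.finRange n).reverse.map (fun k => xi d (Sum.inr k))

/-- The successive unit segments (unordered pairs of end points) of the path that starts at a given
point and follows the given directions. -/
def pathSegments : ℤ × ℤ → List Compass → List (Sym2 (ℤ × ℤ))
  | _, [] => []
  | p, c :: cs => s(p, p + c.step) :: pathSegments (p + c.step) cs

/-- The segments of the polygonal path of `d` that are not discarded: those traversed exactly
once. -/
def keptSegments {n : ℕ} (d : PlanarDiagram n) : Set (Sym2 (ℤ × ℤ)) :=
  {s | (pathSegments (0, 0) (xiVector d)).count s = 1}

/-- The boxes enclosed by the kept segments. The box with southeastern corner `(i, j)` is enclosed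
if the horizontal ray from its centre to the east meets an odd number of kept segments; the segments
that this ray can meet are those joining `(i - 1, y)` to `(i, y)` with `y ≥ j`. -/
def enclosedBoxes {n : ℕ} (d : PlanarDiagram n) : Set (ℤ × ℤ) :=
  {b | Odd (Set.ncard {y : ℤ | b.2 ≤ y ∧ s((b.1 - 1, y), (b.1, y)) ∈ keptSegments d})}

/-! A diagram `d` is encoded by two lattice paths from a common start to a common end. After `k`
steps a path that has made `p k` west steps (and, for the southern vertices, is read backwards)
stands at `(k - p k, -p k)`. The path `northPath` goes west at northern left ends, and `southPath`
goes west at southern right ends. A box on the diagonal with label `k`, in column `j`, lies between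
the paths iff `southPath k ≤ -j < northPath k`. So diagonal `k` has `northPath k - southPath k`
boxes, and `crossing_eq` shows that this is half the number of arcs that cross the vertical line in
front of column `k`. In particular the paths never cross, and they agree for `k ≤ 0` and `k ≥ n`.
Bowman's closed walk is made of these two paths, and parity along an eastward ray shows that it
encloses exactly the boxes between them (`enclosedBoxes_eq`).

Left multiplication by `ê_i` raises the crossing number at `i` by at most 2 and raises no other.
Hence every word for `d` contains the letter `k` at least as often as the shape has boxes labelled
`k`. Conversely, the labels of any skew shape, read along any linear extension of the product order,
form a word in which each letter adds exactly one box and closes no loop (`exists_wordProduct`).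
Such a word is therefore reduced, and the shape of its product is BJS-equivalent to the shape that
was read.

A BJS-class determines the lengths of the diagonals and the relative position of adjacent nonempty
ones. These determine the steps of both paths, and the steps determine the diagram (`ext_steps`,
`eq_of_bjsEquiv`). This gives the bijection.

By convexity, row reading words of skew shapes are the words of Jones shape. If such a word is a
reduced expression of `d`, its skew shape is equivalent to that of `d`; since the row reading word
is a BJS-invariant, the normal form is unique. Columns give the dual statement. -/

theorem DVertex.clockwise_injective {n : ℕ} : Function.Injective (DVertex.clockwise (n := n)) := by
  rintro (⟨x, hx⟩ | ⟨x, hx⟩) (⟨y, hy⟩ | ⟨y, hy⟩) h <;> simp only [DVertex.clockwise] at h <;>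
    first
    | omega
    | (simp only [Sum.inl.injEq, Sum.inr.injEq, Fin.mk.injEq]; omega)

/-! ### The matching of `ê_i D` and its planarity. -/

namespace PlanarDiagram

variable {n : ℕ}

theorem ext_partner {D E : PlanarDiagram n} (h : ∀ x, D.partner x = E.partner x) : D = E := by
  cases D; cases E; congr; exact funext h

theorem partner_eq_comm (D : PlanarDiagram n) {x y : DVertex n} :
    D.partner x = y ↔ D.partner y = x := by
  constructor <;> rintro rfl <;> exact D.partner_partner _

theorem partner_injective (D : PlanarDiagram n) : Function.Injective D.partner := by
  intro x y h
  rw [← D.partner_partner x, h, D.partner_partner]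

/-- Two distinct arcs do not cross: the two ends of one of them lie on the same side of the
other. -/
theorem not_cross (D : PlanarDiagram n) {x y : DVertex n} (h : y ≠ x) (h' : y ≠ D.partner x) :
    ((x.clockwise < y.clockwise ∧ y.clockwise < (D.partner x).clockwise) ∨
      ((D.partner x).clockwise < y.clockwise ∧ y.clockwise < x.clockwise)) ↔
    ((x.clockwise < (D.partner y).clockwise ∧
        (D.partner y).clockwise < (D.partner x).clockwise) ∨
      ((D.partner x).clockwise < (D.partner y).clockwise ∧
        (D.partner y).clockwise < x.clockwise)) := by
  have h1 := D.planar x y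
  have h2 := D.planar x (D.partner y)
  have h3 := D.planar (D.partner x) y
  have h4 := D.planar (D.partner x) (D.partner y)
  have h5 := D.planar y x
  have h6 := D.planar y (D.partner x)
  have h7 := D.planar (D.partner y) x
  have h8 := D.planar (D.partner y) (D.partner x)
  simp only [D.partner_partner] at h1 h2 h3 h4 h5 h6 h7 h8
  have e1 : y.clockwise ≠ x.clockwise := fun e => h (DVertex.clockwise_injective e)
  have e2 : y.clockwise ≠ (D.partner x).clockwise := fun e => h' (DVertex.clockwise_injective e)
  have e3 : (D.partner y).clockwise ≠ x.clockwise := fun e =>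
    h' (D.partner_eq_comm.1 (DVertex.clockwise_injective e)).symm
  have e4 : (D.partner y).clockwise ≠ (D.partner x).clockwise := fun e =>
    h (D.partner_injective (DVertex.clockwise_injective e))
  omega

/-- Planarity from the symmetric non-crossing condition. -/
theorem planar_of_not_cross {f : DVertex n → DVertex n}
    (h : ∀ x y, y ≠ x → y ≠ f x →
      ((x.clockwise < y.clockwise ∧ y.clockwise < (f x).clockwise) →
      ((x.clockwise < (f y).clockwise ∧ (f y).clockwise < (f x).clockwise) ∨
        ((f x).clockwise < (f y).clockwise ∧ (f y).clockwise < x.clockwise)))) (x y : DVertex n) :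
    ¬ (DVertex.clockwise x < DVertex.clockwise y ∧ DVertex.clockwise y < DVertex.clockwise (f x) ∧
      DVertex.clockwise (f x) < DVertex.clockwise (f y)) := by
  rintro ⟨h1, h2, h3⟩
  have := h x y (by rintro rfl; omega) (by rintro rfl; omega) ⟨h1, h2⟩
  omega

/-- The northern vertex in column `i - 1`. -/
abbrev capLeft {i : ℕ} (hin : i < n) : DVertex n := Sum.inl ⟨i - 1, by omega⟩

/-- The northern vertex in column `i`. -/
abbrev capRight {i : ℕ} (hin : i < n) : DVertex n := Sum.inl ⟨i, hin⟩

/-- The matching of the diagram `ê_i D`. -/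
def capPartner (D : PlanarDiagram n) {i : ℕ} (hin : i < n) (v : DVertex n) : DVertex n :=
  if v = capLeft hin then capRight hin
  else if v = capRight hin then capLeft hin
  else if v = D.partner (capLeft hin) then D.partner (capRight hin)
  else if v = D.partner (capRight hin) then D.partner (capLeft hin)
  else D.partner v

theorem capLeft_ne_capRight {i : ℕ} (hi : 0 < i) (hin : i < n) :
    (capLeft hin : DVertex n) ≠ capRight hin := by
  simp; omega

/-- This is the case in which the southern cap of `ê_i` closes up with an arc of `D` to a loop:
nothing else is rerouted, because the two rerouting branches of `capPartner` become vacuous. -/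
theorem capPartner_eq_self (D : PlanarDiagram n) {i : ℕ} (hin : i < n)
    (h : D.partner (capLeft hin) = capRight hin) (v : DVertex n) :
    D.capPartner hin v = D.partner v := by
  have h' := D.partner_eq_comm.1 h
  unfold capPartner
  split_ifs with h1 h2 h3 h4
  · rw [h1, h]
  · rw [h2, h']
  · rw [h] at h3; exact absurd h3 h2
  · rw [h'] at h4; exact absurd h4 h1
  · rfl

theorem capPartner_capPartner (D : PlanarDiagram n) {i : ℕ} (hi : 0 < i) (hin : i < n)
    (v : DVertex n) : D.capPartner hin (D.capPartner hin v) = v := by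
  by_cases h : D.partner (capLeft hin) = capRight hin
  · rw [capPartner_eq_self D hin h, capPartner_eq_self D hin h, D.partner_partner]
  have hne := capLeft_ne_capRight hi hin
  unfold capPartner
  have inv := D.partner_partner
  have nef := D.partner_ne
  -- What remains concerns a fixed-point-free involution `f` and two points `a ≠ b`; planarity plays
  -- no role.
  generalize D.partner = f at *
  generalize capLeft hin = a at *
  generalize capRight hin = b at *
  grind

theorem capPartner_ne (D : PlanarDiagram n) {i : ℕ} (hi : 0 < i) (hin : i < n)
    (v : DVertex n) : D.capPartner hin v ≠ v := by
  have hne := capLeft_ne_capRight hi hin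
  unfold capPartner
  have inv := D.partner_partner
  have nef := D.partner_ne
  generalize D.partner = f at *
  generalize capLeft hin = a at *
  generalize capRight hin = b at *
  grind

/-- The new arc from `f a` to `f b` can be drawn along the old arcs of `a` and `b`. An arc that
avoids both of them has its two ends on the same side of each, hence on the same side of the new
arc, since no vertex lies between `a` and `b`. -/
theorem capPartner_planar (D : PlanarDiagram n) {i : ℕ} (hi : 0 < i) (hin : i < n) :
    ∀ x y : DVertex n, ¬ (DVertex.clockwise x < DVertex.clockwise y ∧
      DVertex.clockwise y < DVertex.clockwise (D.capPartner hin x) ∧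
      DVertex.clockwise (D.capPartner hin x) < DVertex.clockwise (D.capPartner hin y)) := by
  by_cases h : D.partner (capLeft hin) = capRight hin
  · intro x y
    rw [capPartner_eq_self D hin h, capPartner_eq_self D hin h]
    exact D.planar x y
  have hne := capLeft_ne_capRight hi hin
  apply planar_of_not_cross
  intro v u huv hufv
  have inv := D.partner_partner
  have nef := D.partner_ne
  have inj : ∀ s t : DVertex n, s.clockwise = t.clockwise → s = t :=
    fun s t e => DVertex.clockwise_injective e
  have cross := fun s t => D.not_cross (x := s) (y := t)
  -- Adjacency of the two vertices in the clockwise order: no arc can separate them without ending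
  -- at one of them.
  have ha : (capLeft hin : DVertex n).clockwise + 1 = (capRight hin : DVertex n).clockwise := by
    simp only [DVertex.clockwise]; omega
  unfold capPartner at *
  generalize D.partner = f at *
  generalize capLeft hin = a at *
  generalize capRight hin = b at *
  have hab : a.clockwise ≠ b.clockwise := by omega
  have ca : ∀ s, s ≠ a → s.clockwise ≠ a.clockwise := fun s e e' => e (inj _ _ e')
  have cb : ∀ s, s ≠ b → s.clockwise ≠ b.clockwise := fun s e e' => e (inj _ _ e')
  have hba : f b ≠ a := fun e => h (by rw [← e, inv])
  have hfb := ca _ hba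
  have hfa := cb _ h
  have hfa' := ca _ (nef a)
  have hfb' := cb _ (nef b)
  by_cases v1 : v = a
  · subst v1; simp only [if_true]; intro; omega
  by_cases v2 : v = b
  · subst v2; simp only [if_true, if_neg v1]; intro; omega
  have gv1 := ca _ v1
  have gv2 := cb _ v2
  by_cases u1 : u = a
  · subst u1
    simp only [if_true, if_neg v1, if_neg v2] at hufv ⊢
    have := ca _ hufv.symm
    split_ifs at hufv this ⊢ with h1 h2
    · intro; omega
    · intro; omega
    · have := cb (f v) (fun e => h2 (by rw [← e, inv]))
      intro; omega
  by_cases u2 : u = b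
  · subst u2
    simp only [if_true, if_neg v1, if_neg v2, if_neg u1] at hufv ⊢
    have := cb _ hufv.symm
    split_ifs at hufv this ⊢ with h1 h2
    · intro; omega
    · intro; omega
    · have := ca (f v) (fun e => h1 (by rw [← e, inv]))
      intro; omega
  have gu1 := ca _ u1
  have gu2 := cb _ u2
  simp only [if_neg v1, if_neg v2, if_neg u1, if_neg u2] at hufv ⊢
  have fua : (f u).clockwise ≠ (f a).clockwise := fun e => u1 (by rw [← inv u, inj _ _ e, inv])
  have fub : (f u).clockwise ≠ (f b).clockwise := fun e => u2 (by rw [← inv u, inj _ _ e, inv])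
  by_cases v3 : v = f a
  · subst v3
    simp only [if_true] at hufv ⊢
    rw [if_neg huv, if_neg hufv]
    have k1 := cross u a (Ne.symm u1) (fun e => huv (by rw [e, inv]))
    have k2 := cross u b (Ne.symm u2) (fun e => hufv (by rw [e, inv]))
    have k3 := cross a u u1 huv
    have k4 := cross b u u2 hufv
    have := ca (f u) (fun e => huv (by rw [← e, inv]))
    have := cb (f u) (fun e => hufv (by rw [← e, inv]))
    intro; omega
  by_cases v4 : v = f b
  · subst v4
    simp only [if_true, if_neg v3] at hufv ⊢
    rw [if_neg huv, if_neg hufv]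
    have k1 := cross u a (Ne.symm u1) (fun e => hufv (by rw [e, inv]))
    have k2 := cross u b (Ne.symm u2) (fun e => huv (by rw [e, inv]))
    have k3 := cross a u u1 hufv
    have k4 := cross b u u2 huv
    have := ca (f u) (fun e => hufv (by rw [← e, inv]))
    have := cb (f u) (fun e => huv (by rw [← e, inv]))
    intro; omega
  simp only [if_neg v3, if_neg v4] at hufv ⊢
  have w1 : f v ≠ a := fun e => v3 (by rw [← e, inv])
  have w2 : f v ≠ b := fun e => v4 (by rw [← e, inv])
  have := ca _ w1
  have := cb _ w2
  have k1 := cross v a (Ne.symm v1) w1.symm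
  have k2 := cross v b (Ne.symm v2) w2.symm
  have k3 := cross v u huv hufv
  split_ifs with h1 h2
  · subst h1; intro; omega
  · subst h2; intro; omega
  · intro; omega

/-- The diagram `D'` such that `ê_i D = δ ^ L D'`. -/
def mulGen (D : PlanarDiagram n) (i : ℕ) (hi : 0 < i) (hin : i < n) : PlanarDiagram n where
  partner := D.capPartner hin
  partner_partner := D.capPartner_capPartner hi hin
  partner_ne := D.capPartner_ne hi hin
  planar := D.capPartner_planar hi hin

end PlanarDiagram

/-! ### The stack graph of `ê_i` and `D`: strings and loops. -/

section Products

open PlanarDiagram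

variable {n : ℕ}

theorem stackGraph_reachable_upper (D₁ D₂ : PlanarDiagram n) (x : DVertex n) :
    (stackGraph D₁ D₂).Reachable (upperVertex x) (upperVertex (D₁.partner x)) := by
  by_cases h : upperVertex x = upperVertex (D₁.partner x)
  · rw [← h]
  · exact SimpleGraph.Adj.reachable
      ((SimpleGraph.fromRel_adj _ _ _).2 ⟨h, Or.inl (Or.inl ⟨x, rfl, rfl⟩)⟩)

theorem stackGraph_reachable_lower (D₁ D₂ : PlanarDiagram n) (x : DVertex n) :
    (stackGraph D₁ D₂).Reachable (lowerVertex x) (lowerVertex (D₂.partner x)) := by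
  by_cases h : lowerVertex x = lowerVertex (D₂.partner x)
  · rw [← h]
  · exact SimpleGraph.Adj.reachable
      ((SimpleGraph.fromRel_adj _ _ _).2 ⟨h, Or.inl (Or.inr ⟨x, rfl, rfl⟩)⟩)

theorem genDiagram_partner_inl {i : ℕ} (hi : 0 < i) (hin : i < n) {k : Fin n}
    (h1 : (Sum.inl k : DVertex n) ≠ capLeft hin) (h2 : (Sum.inl k : DVertex n) ≠ capRight hin) :
    (genDiagram n i hi hin).partner (Sum.inl k) = Sum.inr k := by
  simp only [ne_eq, Sum.inl.injEq, Fin.ext_iff] at h1 h2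
  simp only [genDiagram]
  rw [if_neg (by omega), if_neg (by omega)]

theorem genDiagram_partner_capLeft {i : ℕ} (hi : 0 < i) (hin : i < n) :
    (genDiagram n i hi hin).partner (capLeft hin) = capRight hin := by
  simp only [genDiagram]
  rw [if_pos (by omega)]

theorem genDiagram_partner_inr_pred {i : ℕ} (hi : 0 < i) (hin : i < n) :
    (genDiagram n i hi hin).partner (Sum.inr ⟨i - 1, by omega⟩) = Sum.inr ⟨i, hin⟩ := by
  simp only [genDiagram]
  rw [if_pos (by omega)]

theorem stackGraph_reachable_outer_lower {i : ℕ} (hi : 0 < i) (hin : i < n) (D : PlanarDiagram n)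
    {x : DVertex n} (h1 : x ≠ capLeft hin) (h2 : x ≠ capRight hin) :
    (stackGraph (genDiagram n i hi hin) D).Reachable (outerVertex x) (lowerVertex x) := by
  rcases x with k | k
  · have := stackGraph_reachable_upper (genDiagram n i hi hin) D (Sum.inl k)
    rw [genDiagram_partner_inl hi hin h1 h2] at this
    exact this
  · exact SimpleGraph.Reachable.refl _

theorem stackGraph_reachable_middle {i : ℕ} (hi : 0 < i) (hin : i < n) (D : PlanarDiagram n) :
    (stackGraph (genDiagram n i hi hin) D).Reachable
      (lowerVertex (capLeft hin)) (lowerVertex (capRight hin)) := by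
  have := stackGraph_reachable_upper (genDiagram n i hi hin) D (Sum.inr ⟨i - 1, by omega⟩)
  rw [genDiagram_partner_inr_pred hi hin] at this
  exact this

/-- Follow the string: it descends along a vertical arc of `ê_i` (unless it starts at the northern
cap), follows an arc of `D`, and, if that arc ends at the southern cap of `ê_i`, passes the cap and
follows a second arc of `D`. -/
theorem stackGraph_reachable_mulGen {i : ℕ} (hi : 0 < i) (hin : i < n) (D : PlanarDiagram n)
    (x : DVertex n) : (stackGraph (genDiagram n i hi hin) D).Reachable
      (outerVertex x) (outerVertex ((D.mulGen i hi hin).partner x)) := by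
  have cap : (stackGraph (genDiagram n i hi hin) D).Reachable
      (outerVertex (capLeft hin)) (outerVertex (capRight hin)) := by
    have := stackGraph_reachable_upper (genDiagram n i hi hin) D (capLeft hin)
    rw [genDiagram_partner_capLeft hi hin] at this
    exact this
  have out := fun {v : DVertex n} => stackGraph_reachable_outer_lower hi hin D (x := v)
  have low := fun v => stackGraph_reachable_lower (genDiagram n i hi hin) D v
  have mid := stackGraph_reachable_middle hi hin D
  have hne := capLeft_ne_capRight hi hin
  simp only [mulGen, capPartner]
  split_ifs with h1 h2 h3 h4
  · rw [h1]; exact cap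
  · rw [h2]; exact cap.symm
  · have hl := out h1 h2
    have hr := out (v := D.partner (capRight hin))
      (fun e => h2 (by rw [h3, ← e, D.partner_partner])) (D.partner_ne _)
    have e1 := low (capLeft hin)
    have e2 := low (capRight hin)
    rw [← h3] at e1
    exact hl.trans (e1.symm.trans (mid.trans (e2.trans hr.symm)))
  · have hl := out h1 h2
    have hr := out (v := D.partner (capLeft hin)) (D.partner_ne _)
      (fun e => h1 (by rw [h4, ← e, D.partner_partner]))
    have e1 := low (capLeft hin)
    have e2 := low (capRight hin)
    rw [← h4] at e2
    exact hl.trans (e2.symm.trans (mid.symm.trans (e1.trans hr.symm)))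
  · exact (out h1 h2).trans ((low x).trans (out
      (fun e => h3 (by rw [← e, D.partner_partner]))
      (fun e => h4 (by rw [← e, D.partner_partner]))).symm)

/-- An end, in the product `ê_i D`, of the string through a vertex of the stack. -/
def stackEnd (D : PlanarDiagram n) {i : ℕ} (hin : i < n) : StackVertex n → DVertex n
  | Sum.inl k => Sum.inl k
  | Sum.inr (Sum.inl k) =>
      if (Sum.inl k : DVertex n) = capLeft hin ∨ (Sum.inl k : DVertex n) = capRight hin then
        D.partner (Sum.inl k) else Sum.inl k
  | Sum.inr (Sum.inr k) => Sum.inr k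

theorem stackEnd_outerVertex (D : PlanarDiagram n) {i : ℕ} (hin : i < n) (x : DVertex n) :
    stackEnd D hin (outerVertex x) = x := by
  rcases x with k | k <;> rfl

theorem stackEnd_lowerVertex (D : PlanarDiagram n) {i : ℕ} (hin : i < n) (x : DVertex n) :
    stackEnd D hin (lowerVertex x) =
      if x = capLeft hin ∨ x = capRight hin then D.partner x else x := by
  rcases x with k | k
  · rfl
  · simp [lowerVertex, stackEnd]

/-- Along an edge of the stack `stackEnd` changes at most by the matching of the product. This
survives in the loop case: the two middle vertices of the loop are then sent to the two northern
vertices of the cap, which are matched. -/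
theorem stackEnd_lower (D : PlanarDiagram n) {i : ℕ} (hi : 0 < i) (hin : i < n) (x : DVertex n) :
    stackEnd D hin (lowerVertex (D.partner x)) = stackEnd D hin (lowerVertex x) ∨
    stackEnd D hin (lowerVertex (D.partner x)) =
      (D.mulGen i hi hin).partner (stackEnd D hin (lowerVertex x)) := by
  simp only [stackEnd_lowerVertex, mulGen, capPartner]
  have hne := capLeft_ne_capRight hi hin
  have inv := D.partner_partner
  have nef := D.partner_ne
  generalize D.partner = f at *
  generalize capLeft hin = a at *
  generalize capRight hin = b at *
  grind

theorem stackEnd_upper (D : PlanarDiagram n) {i : ℕ} (hi : 0 < i) (hin : i < n) (x : DVertex n) :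
    stackEnd D hin (upperVertex ((genDiagram n i hi hin).partner x)) =
      stackEnd D hin (upperVertex x) ∨
    stackEnd D hin (upperVertex ((genDiagram n i hi hin).partner x)) =
      (D.mulGen i hi hin).partner (stackEnd D hin (upperVertex x)) := by
  have hne := capLeft_ne_capRight hi hin
  have inv := D.partner_partner
  have nef := D.partner_ne
  have e0 : ∀ k : Fin n, stackEnd D hin (upperVertex (Sum.inl k)) = Sum.inl k := fun _ => rfl
  have e1 : ∀ k : Fin n, stackEnd D hin (upperVertex (Sum.inr k)) =
    if (Sum.inl k : DVertex n) = capLeft hin ∨ (Sum.inl k : DVertex n) = capRight hin then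
        D.partner (Sum.inl k) else Sum.inl k := fun _ => rfl
  have hF : ∀ v, (D.mulGen i hi hin).partner v = D.capPartner hin v := fun _ => rfl
  have hlt : i - 1 < n := by omega
  have eL : stackEnd D hin (upperVertex (Sum.inr ⟨i - 1, hlt⟩)) = D.partner (capLeft hin) := by
    rw [e1, if_pos (Or.inl rfl)]
  have eR : stackEnd D hin (upperVertex (Sum.inr ⟨i, hin⟩)) = D.partner (capRight hin) := by
    rw [e1, if_pos (Or.inr rfl)]
  rcases x with k | k <;> simp only [genDiagram] <;> split_ifs with h1 h2
  · obtain rfl : k = ⟨i - 1, hlt⟩ := Fin.ext (by simp; omega)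
    right; simp only [e0, hF, capPartner, if_true]
  · obtain rfl : k = ⟨i, hin⟩ := Fin.ext h2
    right; simp only [e0, hF, capPartner, if_true, if_neg hne.symm]
  · left
    rw [e1, e0, if_neg]
    simp only [Sum.inl.injEq, Fin.ext_iff]; omega
  · obtain rfl : k = ⟨i - 1, hlt⟩ := Fin.ext (by simp; omega)
    right
    rw [eL, eR, hF, capPartner]
    generalize D.partner = f at *
    generalize capLeft hin = a at *
    generalize capRight hin = b at *
    grind
  · obtain rfl : k = ⟨i, hin⟩ := Fin.ext h2
    right
    rw [eL, eR, hF, capPartner]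
    generalize D.partner = f at *
    generalize capLeft hin = a at *
    generalize capRight hin = b at *
    grind
  · left
    rw [e1, e0, if_neg]
    simp only [Sum.inl.injEq, Fin.ext_iff]; omega

/-- Invariance along edges propagates along walks. As `stackEnd` fixes the outer vertices, a
component contains no outer vertices beyond one vertex and its partner. -/
theorem stackEnd_of_reachable (D : PlanarDiagram n) {i : ℕ} (hi : 0 < i) (hin : i < n)
    {u v : StackVertex n} (h : (stackGraph (genDiagram n i hi hin) D).Reachable u v) :
    stackEnd D hin v = stackEnd D hin u ∨
      stackEnd D hin v = (D.mulGen i hi hin).partner (stackEnd D hin u) := by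
  obtain ⟨p⟩ := h
  induction p with
  | nil => exact Or.inl rfl
  | @cons u v w huv _ ih =>
    have key : stackEnd D hin v = stackEnd D hin u ∨
        stackEnd D hin v = (D.mulGen i hi hin).partner (stackEnd D hin u) := by
      rcases ((SimpleGraph.fromRel_adj _ _ _).1 huv).2 with
        (⟨x, rfl, rfl⟩ | ⟨x, rfl, rfl⟩) | (⟨x, rfl, rfl⟩ | ⟨x, rfl, rfl⟩)
      · exact stackEnd_upper D hi hin x
      · exact stackEnd_lower D hi hin x
      · rcases stackEnd_upper D hi hin x with h | h
        · exact Or.inl h.symm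
        · exact Or.inr ((D.mulGen i hi hin).partner_eq_comm.1 h.symm).symm
      · rcases stackEnd_lower D hi hin x with h | h
        · exact Or.inl h.symm
        · exact Or.inr ((D.mulGen i hi hin).partner_eq_comm.1 h.symm).symm
    rcases key with h | h <;> rcases ih with h' | h' <;> rw [h] at h'
    · exact Or.inl h'
    · exact Or.inr h'
    · exact Or.inr h'
    · rw [PlanarDiagram.partner_partner] at h'; exact Or.inl h'

theorem mulGen_partner_iff_reachable (D : PlanarDiagram n) {i : ℕ} (hi : 0 < i) (hin : i < n)
    {x y : DVertex n} (hxy : x ≠ y) : (D.mulGen i hi hin).partner x = y ↔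
      (stackGraph (genDiagram n i hi hin) D).Reachable (outerVertex x) (outerVertex y) := by
  constructor
  · rintro rfl
    exact stackGraph_reachable_mulGen hi hin D x
  · intro h
    have := stackEnd_of_reachable D hi hin h
    simp only [stackEnd_outerVertex] at this
    rcases this with h | h
    · exact absurd h.symm hxy
    · exact h.symm

theorem IsProduct.eq_mulGen {D E : PlanarDiagram n} {i M : ℕ} {hi : 0 < i} {hin : i < n}
    (h : IsProduct (genDiagram n i hi hin) D M E) : E = D.mulGen i hi hin := by
  apply ext_partner
  intro x
  exact (h.2 x _ ((D.mulGen i hi hin).partner_ne x).symm).2 (stackGraph_reachable_mulGen hi hin D x)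

/-- A middle vertex away from the cap continues vertically to the north. A middle vertex under the
cap is joined by `D` to something other than its neighbour, which again leads to an outer vertex. -/
theorem loopCount_genDiagram_eq_zero {D : PlanarDiagram n} {i : ℕ} (hi : 0 < i) (hin : i < n)
    (h : D.partner (capLeft hin) ≠ capRight hin) :
    loopCount (genDiagram n i hi hin) D = 0 := by
  unfold loopCount
  rw [Set.ncard_eq_zero (Set.toFinite _), Set.eq_empty_iff_forall_notMem]
  intro c
  induction c using SimpleGraph.ConnectedComponent.ind with | _ v => ?_
  simp only [Set.mem_ofPred_eq, not_forall, not_not, SimpleGraph.ConnectedComponent.eq]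
  rcases v with k | k | k
  · exact ⟨Sum.inl k, SimpleGraph.Reachable.refl _⟩
  · by_cases h1 : (Sum.inl k : DVertex n) = capLeft hin
    · refine ⟨D.partner (capLeft hin), ?_⟩
      have := stackGraph_reachable_lower (genDiagram n i hi hin) D (capLeft hin)
      refine (stackGraph_reachable_outer_lower hi hin D (D.partner_ne _) h).trans ?_
      rw [← h1] at this ⊢
      exact this.symm
    · by_cases h2 : (Sum.inl k : DVertex n) = capRight hin
      · refine ⟨D.partner (capRight hin), ?_⟩
        have := stackGraph_reachable_lower (genDiagram n i hi hin) D (capRight hin)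
        refine (stackGraph_reachable_outer_lower hi hin D
          (fun e => h (D.partner_eq_comm.1 e)) (D.partner_ne _)).trans ?_
        rw [← h2] at this ⊢
        exact this.symm
      · exact ⟨Sum.inl k, stackGraph_reachable_outer_lower hi hin D h1 h2⟩
  · exact ⟨Sum.inr k, SimpleGraph.Reachable.refl _⟩

theorem isProduct_mulGen {D : PlanarDiagram n} {i : ℕ} (hi : 0 < i) (hin : i < n)
    (h : D.partner (capLeft hin) ≠ capRight hin) :
    IsProduct (genDiagram n i hi hin) D 0 (D.mulGen i hi hin) :=
  ⟨(loopCount_genDiagram_eq_zero hi hin h).symm,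
    fun _ _ hxy => mulGen_partner_iff_reachable D hi hin hxy⟩

theorem WordProduct.unique {w : List ℕ} {L M : ℕ} {D E : PlanarDiagram n}
    (h : WordProduct w L D) (h' : WordProduct w M E) : D = E := by
  induction h generalizing M E with
  | nil => cases h'; rfl
  | cons hi hin _ hp ih =>
    cases h' with
    | cons hi' hin' hw' hp' =>
      obtain rfl := ih hw'
      rw [hp.eq_mulGen, hp'.eq_mulGen]

end Products

/-! ### Arc ends, the two paths of a diagram and crossing numbers. -/

namespace PlanarDiagram

variable {n : ℕ}

/-- `1` for the left end of an arc, `-1` for the right end, `0` for the ends of a vertical arc. -/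
def turn (d : PlanarDiagram n) (v : DVertex n) : ℤ :=
  if v.col < (d.partner v).col then 1 else if (d.partner v).col < v.col then -1 else 0

/-- `1` if the northern vertex in column `k` is the left end of an arc, else `0`. -/
def northStep (d : PlanarDiagram n) (k : ℕ) : ℤ :=
  if h : k < n then
    (if (⟨k, h⟩ : Fin n) < (d.partner (Sum.inl ⟨k, h⟩)).col then 1 else 0) else 0

/-- `1` if the southern vertex in column `k` is the right end of an arc, else `0`. -/
def southStep (d : PlanarDiagram n) (k : ℕ) : ℤ :=
  if h : k < n then
    (if (⟨k, h⟩ : Fin n) ≤ (d.partner (Sum.inr ⟨k, h⟩)).col then 0 else 1) else 0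

/-- The number of northern left ends in columns less than `k`. -/
def northPath (d : PlanarDiagram n) (k : ℤ) : ℤ := ∑ j ∈ Finset.range k.toNat, d.northStep j

/-- The number of southern right ends in columns less than `k`. -/
def southPath (d : PlanarDiagram n) (k : ℤ) : ℤ := ∑ j ∈ Finset.range k.toNat, d.southStep j

/-- The number of arcs from columns less than `k` to columns at least `k`. -/
def crossing (d : PlanarDiagram n) (k : ℕ) : ℤ :=
  ∑ v : DVertex n, if (v.col : ℕ) < k ∧ k ≤ ((d.partner v).col : ℕ) then 1 else 0

theorem partner_inl_of_col_eq (d : PlanarDiagram n) {k : Fin n}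
    (h : (d.partner (Sum.inl k)).col = k) : d.partner (Sum.inl k) = Sum.inr k := by
  have := d.partner_ne (Sum.inl k)
  revert h this
  rcases d.partner (Sum.inl k) with j | j <;> simp [DVertex.col]

theorem partner_inr_of_col_eq (d : PlanarDiagram n) {k : Fin n}
    (h : (d.partner (Sum.inr k)).col = k) : d.partner (Sum.inr k) = Sum.inl k := by
  have := d.partner_ne (Sum.inr k)
  revert h this
  rcases d.partner (Sum.inr k) with j | j <;> simp [DVertex.col]

theorem turn_partner (d : PlanarDiagram n) (v : DVertex n) : d.turn (d.partner v) = - d.turn v := by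
  unfold turn
  rw [d.partner_partner]
  split_ifs <;> omega

theorem northStep_coe (d : PlanarDiagram n) (k : Fin n) :
    d.northStep k = if k < (d.partner (Sum.inl k)).col then 1 else 0 := by
  simp [northStep]

theorem southStep_coe (d : PlanarDiagram n) (k : Fin n) :
    d.southStep k = if k ≤ (d.partner (Sum.inr k)).col then 0 else 1 := by
  simp [southStep]

theorem northStep_of_le (d : PlanarDiagram n) {k : ℕ} (h : n ≤ k) : d.northStep k = 0 :=
  dif_neg (by omega)

theorem southStep_of_le (d : PlanarDiagram n) {k : ℕ} (h : n ≤ k) : d.southStep k = 0 :=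
  dif_neg (by omega)

theorem northStep_mem (d : PlanarDiagram n) (k : ℕ) : d.northStep k = 0 ∨ d.northStep k = 1 := by
  unfold northStep; split_ifs <;> simp

theorem southStep_mem (d : PlanarDiagram n) (k : ℕ) : d.southStep k = 0 ∨ d.southStep k = 1 := by
  unfold southStep; split_ifs <;> simp

/-- Off vertical arcs, a northern vertex turns by `2 * northStep - 1` and a southern one by `1 - 2 *
southStep`. A vertical arc contributes 0 on both sides, thanks to the strict inequality in the north
and the weak one in the south. -/
theorem turn_inl_add_turn_inr (d : PlanarDiagram n) (k : Fin n) :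
    d.turn (Sum.inl k) + d.turn (Sum.inr k) = 2 * (d.northStep k - d.southStep k) := by
  rw [northStep_coe, southStep_coe]
  have e1 : DVertex.col (Sum.inl k : DVertex n) = k := rfl
  have e2 : DVertex.col (Sum.inr k : DVertex n) = k := rfl
  by_cases h : (d.partner (Sum.inl k)).col = k
  · have h1 := d.partner_inl_of_col_eq h
    have h2 := d.partner_eq_comm.1 h1
    simp [turn, h1, h2, e1, e2]
  · have h' : (d.partner (Sum.inr k)).col ≠ k := by
      intro h2
      have h2 := d.partner_inr_of_col_eq h2
      rw [d.partner_eq_comm.1 h2] at h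
      exact h rfl
    simp only [turn, e1, e2]
    split_ifs <;> first | rfl | omega

theorem northPath_natCast_succ (d : PlanarDiagram n) (k : ℕ) :
    d.northPath (k + 1) = d.northPath k + d.northStep k := by
  have h1 : ((k : ℤ) + 1).toNat = k + 1 := by omega
  simp only [northPath, h1, Int.toNat_natCast, Finset.sum_range_succ]

theorem southPath_natCast_succ (d : PlanarDiagram n) (k : ℕ) :
    d.southPath (k + 1) = d.southPath k + d.southStep k := by
  have h1 : ((k : ℤ) + 1).toNat = k + 1 := by omega
  simp only [southPath, h1, Int.toNat_natCast, Finset.sum_range_succ]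

theorem northPath_of_nonpos (d : PlanarDiagram n) {k : ℤ} (h : k ≤ 0) : d.northPath k = 0 := by
  simp [northPath, Int.toNat_of_nonpos h]

theorem southPath_of_nonpos (d : PlanarDiagram n) {k : ℤ} (h : k ≤ 0) : d.southPath k = 0 := by
  simp [southPath, Int.toNat_of_nonpos h]

/-- The turns of an arc with both ends left of the line cancel, and an arc with one end there
contributes the `1` of its left end. -/
theorem crossing_eq_sum_turn (d : PlanarDiagram n) (k : ℕ) :
    d.crossing k = ∑ v : DVertex n, if (v.col : ℕ) < k then d.turn v else 0 := by
  have h0 : ∑ v : DVertex n, (if (v.col : ℕ) < k ∧ ((d.partner v).col : ℕ) < k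
      then d.turn v else 0) = 0 := by
    -- The cancelling pairs are the blocks of `d`.
    refine Finset.sum_involution (fun v _ => d.partner v) ?_ ?_ ?_ ?_
    · intro v _
      rw [d.partner_partner, turn_partner]
      split_ifs <;> omega
    · intro v _ _; exact d.partner_ne v
    · intro v _; exact Finset.mem_univ _
    · intro v _; exact d.partner_partner v
  refine Eq.trans ?_ (sub_zero _)
  refine Eq.trans ?_ (congrArg _ h0)
  rw [← Finset.sum_sub_distrib, crossing]
  refine Finset.sum_congr rfl fun v _ => ?_
  unfold turn
  split_ifs <;> first | rfl | omega

/-- Summing the turns column by column turns the geometric count into the distance between the two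
paths. -/
theorem crossing_eq (d : PlanarDiagram n) (k : ℕ) :
    d.crossing k = 2 * (d.northPath k - d.southPath k) := by
  have h1 : ∀ f : Fin n → ℤ, ∀ g : ℕ → ℤ, (∀ j : Fin n, f j = g j) → (∀ j, n ≤ j → g j = 0) →
      ∑ j : Fin n, (if (j : ℕ) < k then f j else 0) = ∑ j ∈ Finset.range k, g j := by
    intro f g hfg hg
    have : ∀ j : Fin n, (if (j : ℕ) < k then f j else 0) =
      (fun m : ℕ => if m < k then g m else 0) j := fun j => by simp [hfg]
    rw [Finset.sum_congr rfl (fun j _ => this j), Fin.sum_univ_eq_sum_range (fun m : ℕ => if m < k then g m else 0), ← Finset.sum_filter,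
      ← Finset.sum_filter_of_ne (s := Finset.range k) (p := fun j => j < n)]
    · congr 1; ext j; simp [and_comm]
    · intro j _ hj; by_contra hn; exact hj (hg j (by omega))
  rw [crossing_eq_sum_turn, Fintype.sum_sum_type, ← Finset.sum_add_distrib]
  have h2 : ∀ j : Fin n, ((if (DVertex.col (Sum.inl j : DVertex n) : ℕ) < k
      then d.turn (Sum.inl j) else 0) + (if (DVertex.col (Sum.inr j : DVertex n) : ℕ) < k
      then d.turn (Sum.inr j) else 0)) =
      if (j : ℕ) < k then d.turn (Sum.inl j) + d.turn (Sum.inr j) else 0 := by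
    intro j
    have e1 : DVertex.col (Sum.inl j : DVertex n) = j := rfl
    have e2 : DVertex.col (Sum.inr j : DVertex n) = j := rfl
    rw [e1, e2]
    split_ifs <;> simp
  rw [Finset.sum_congr rfl (fun j _ => h2 j),
    h1 _ (fun j => 2 * (d.northStep j - d.southStep j)) (fun j => d.turn_inl_add_turn_inr j)
      (fun j hj => by simp [northStep_of_le, southStep_of_le, hj])]
  simp [northPath, southPath, Finset.mul_sum, Finset.sum_sub_distrib, mul_sub]

theorem crossing_nonneg (d : PlanarDiagram n) (k : ℕ) : 0 ≤ d.crossing k :=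
  Finset.sum_nonneg fun _ _ => by split_ifs <;> norm_num

theorem crossing_eq_zero_iff (d : PlanarDiagram n) (k : ℕ) : d.crossing k = 0 ↔
    ∀ v : DVertex n, (v.col : ℕ) < k → ((d.partner v).col : ℕ) < k := by
  unfold crossing
  rw [Finset.sum_eq_zero_iff_of_nonneg fun _ _ => by split_ifs <;> norm_num]
  simp

theorem crossing_of_le (d : PlanarDiagram n) {k : ℕ} (h : n ≤ k) : d.crossing k = 0 :=
  (d.crossing_eq_zero_iff k).2 fun v _ => by omega

theorem southPath_le_northPath (d : PlanarDiagram n) (k : ℤ) : d.southPath k ≤ d.northPath k := by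
  rcases le_total k 0 with h | h
  · rw [northPath_of_nonpos _ h, southPath_of_nonpos _ h]
  · lift k to ℕ using h
    have := d.crossing_nonneg k
    rw [crossing_eq] at this
    omega

theorem southPath_eq_northPath (d : PlanarDiagram n) {k : ℤ} (h : k ≤ 0 ∨ n ≤ k) :
    d.southPath k = d.northPath k := by
  rcases h with h | h
  · rw [northPath_of_nonpos _ h, southPath_of_nonpos _ h]
  · lift k to ℕ using by omega
    have := d.crossing_of_le (k := k) (by omega)
    rw [crossing_eq] at this
    omega

/-- A vertical arc cuts the rectangle in two, and no other arc may cross it. -/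
theorem crossing_of_vertical (d : PlanarDiagram n) {k : Fin n}
    (h : d.partner (Sum.inl k) = Sum.inr k) : d.crossing k = 0 := by
  rw [crossing_eq_zero_iff]
  intro v hv
  by_contra hc
  have hne : v ≠ Sum.inl k := by rintro rfl; exact lt_irrefl _ hv
  have hne' : v ≠ Sum.inr k := by rintro rfl; exact lt_irrefl _ hv
  have := d.not_cross (x := Sum.inl k) (y := v) hne (by rw [h]; exact hne')
  have h1 : d.partner v ≠ Sum.inl k := fun e => hne' (by rw [← h, d.partner_eq_comm.1 e])
  have h2 : d.partner v ≠ Sum.inr k := fun e => hne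
    (by rw [← d.partner_eq_comm.1 h, d.partner_eq_comm.1 e])
  rw [h] at this
  generalize d.partner v = u at *
  rcases v with v | v <;> rcases u with u | u <;>
    simp only [DVertex.clockwise, DVertex.col, ne_eq, Sum.inl.injEq, Sum.inr.injEq,
      Fin.ext_iff] at * <;> omega

theorem crossing_pos_of_right (d : PlanarDiagram n) {v : DVertex n}
    (h : (d.partner v).col < v.col) : d.crossing v.col ≠ 0 := by
  rw [Ne, crossing_eq_zero_iff]
  intro h'
  have := h' (d.partner v) h
  rw [d.partner_partner] at this
  exact lt_irrefl _ this

/-- A northern vertex that is not a left end is either on a vertical arc, which forces crossing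
number 0, or a right end, whose own arc crosses the line. So the crossing number tells them apart,
and the turns become functions of the steps. -/
theorem turn_inl (d : PlanarDiagram n) (k : Fin n) : d.turn (Sum.inl k) =
    if d.northStep k = 1 then 1 else if d.crossing k = 0 then 0 else -1 := by
  rw [northStep_coe]
  have e1 : DVertex.col (Sum.inl k : DVertex n) = k := rfl
  unfold turn
  rw [e1]
  by_cases h1 : k < (d.partner (Sum.inl k)).col
  · simp [h1]
  · by_cases h2 : (d.partner (Sum.inl k)).col < k
    · have := d.crossing_pos_of_right (v := Sum.inl k) h2
      rw [e1] at this
      simp [h1, h2, this]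
    · have := d.crossing_of_vertical (d.partner_inl_of_col_eq (k := k) (by omega))
      simp [h1, h2, this]

theorem turn_inr (d : PlanarDiagram n) (k : Fin n) : d.turn (Sum.inr k) =
    2 * (d.northStep k - d.southStep k) - d.turn (Sum.inl k) := by
  rw [← turn_inl_add_turn_inr]; ring

/-- A planar diagram is determined by the sets of left ends and right ends of its arcs. -/
theorem ext_turn {d e : PlanarDiagram n} (h : ∀ v, d.turn v = e.turn v) : d = e := by
  have turn_one : ∀ (d : PlanarDiagram n) v, d.turn v = 1 ↔ v.col < (d.partner v).col := by
    intro d v; unfold turn; split_ifs <;> simp_all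
  have turn_neg : ∀ (d : PlanarDiagram n) v, d.turn v = -1 ↔ (d.partner v).col < v.col := by
    intro d v; unfold turn; split_ifs <;> simp_all; omega
  -- Right ends are matched in the order of their columns. Suppose `v` is the first one with
  -- different partners in `d` and `e`; both partners lie to its left.
  have right : ∀ (m : ℕ) (v : DVertex n), (v.col : ℕ) = m → d.turn v = -1 →
      d.partner v = e.partner v := by
    intro m
    induction m using Nat.strong_induction_on with
    | _ m ih =>
      intro v hv hd
      by_contra hne
      have he := hd
      rw [h] at he
      have hu := (turn_neg d v).1 hd
      have hu' := (turn_neg e v).1 he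
      have dd := d.partner_partner
      have ee := e.partner_partner
      -- A partner left of column `m` would be an earlier right end, where the two diagrams agree by
      -- induction.
      have hz : m ≤ ((e.partner (d.partner v)).col : ℕ) := by
        by_contra hc
        have h1 : e.turn (d.partner v) = 1 := by rw [← h, turn_partner, hd]; rfl
        have h2 : d.turn (e.partner (d.partner v)) = -1 := by rw [h, turn_partner, h1]
        have h3 := ih _ (by omega) _ rfl h2
        rw [ee] at h3
        have h4 := d.partner_injective h3
        rw [h4, hv] at hc
        exact hc le_rfl
      have hz' : m ≤ ((d.partner (e.partner v)).col : ℕ) := by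
        by_contra hc
        have h1 : d.turn (e.partner v) = 1 := by rw [h, turn_partner, he]; rfl
        have h2 : d.turn (d.partner (e.partner v)) = -1 := by rw [turn_partner, h1]
        have h3 := ih _ (by omega) _ rfl h2
        rw [dd] at h3
        have h4 := e.partner_injective h3
        rw [← h4, hv] at hc
        exact hc le_rfl
      -- In `d` the arc that starts at `e.partner v` reaches column `m` or beyond, so planarity
      -- makes `d.partner v` the nearer of the two vertices to `v` along the boundary left of `v`.
      -- In `e` the roles are exchanged, which is a contradiction.
      have c1 := d.not_cross (x := v) (y := e.partner v) (e.partner_ne v) (Ne.symm hne)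
      have c2 := e.not_cross (x := v) (y := d.partner v) (d.partner_ne v) hne
      have n1 : d.partner (e.partner v) ≠ v := fun e' => hne (d.partner_eq_comm.1 e')
      have n2 : e.partner (d.partner v) ≠ v := fun e' => hne (e.partner_eq_comm.1 e').symm
      have i1 : (d.partner v).clockwise ≠ (e.partner v).clockwise :=
        fun e' => hne (DVertex.clockwise_injective e')
      have i2 : (d.partner (e.partner v)).clockwise ≠ v.clockwise :=
        fun e' => n1 (DVertex.clockwise_injective e')
      have i3 : (e.partner (d.partner v)).clockwise ≠ v.clockwise :=
        fun e' => n2 (DVertex.clockwise_injective e')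
      have cw : ∀ u : DVertex n, u.clockwise = u.col ∨ u.clockwise = 2 * n - 1 - u.col := by
        rintro (u | u)
        · exact Or.inl rfl
        · exact Or.inr rfl
      have w1 := cw (d.partner v)
      have w2 := cw (e.partner v)
      have w3 := cw (d.partner (e.partner v))
      have w4 := cw (e.partner (d.partner v))
      have w5 := cw v
      have hlt := v.col.isLt
      clear dd ee hd he hne cw n1 n2 ih turn_one turn_neg
      rcases w5 with w5 | w5 <;> rcases w1 with w1 | w1 <;> rcases w2 with w2 | w2 <;>
        rcases w3 with w3 | w3 <;> rcases w4 with w4 | w4 <;> omega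
  apply ext_partner
  intro v
  rcases lt_trichotomy v.col (d.partner v).col with hl | hl | hl
  · have h1 : d.turn (d.partner v) = -1 := by rw [turn_partner, (turn_one d v).2 hl]
    have h2 := right _ _ rfl h1
    rw [d.partner_partner] at h2
    exact (e.partner_eq_comm.1 h2.symm).symm
  · have h1 : e.turn v = 0 := by rw [← h]; unfold turn; rw [if_neg (by omega), if_neg (by omega)]
    have h2 : (e.partner v).col = v.col := by
      unfold turn at h1
      split_ifs at h1 <;> omega
    rcases v with v | v
    · rw [d.partner_inl_of_col_eq hl.symm, e.partner_inl_of_col_eq h2]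
    · rw [d.partner_inr_of_col_eq hl.symm, e.partner_inr_of_col_eq h2]
  · exact right _ _ rfl ((turn_neg d v).2 hl)

theorem ext_steps {d e : PlanarDiagram n} (h1 : ∀ k, d.northStep k = e.northStep k)
    (h2 : ∀ k, d.southStep k = e.southStep k) : d = e := by
  have hc : ∀ k, d.crossing k = e.crossing k := by
    intro k
    simp only [crossing_eq, northPath, southPath, h1, h2]
  have hl : ∀ k, d.turn (Sum.inl k) = e.turn (Sum.inl k) := by
    intro k; rw [turn_inl, turn_inl, h1, hc]
  apply ext_turn
  rintro (k | k)
  · exact hl k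
  · rw [turn_inr, turn_inr, hl, h1, h2]

/-! ### The effect of a generator on crossings and steps. -/

/-- The arcs `{a, f a}` and `{b, f b}` are replaced by `{a, b}` and `{f a, f b}`. By the triangle
inequality the latter two cross a line at most as often as the former two plus twice the crossing of
`{a, b}`, which only crosses the line at `i`. -/
theorem crossing_mulGen_le (D : PlanarDiagram n) {i : ℕ} (hi : 0 < i) (hin : i < n) (k : ℕ) :
    (D.mulGen i hi hin).crossing k ≤ D.crossing k + if k = i then 2 else 0 := by
  have hF : ∀ v, (D.mulGen i hi hin).partner v = D.capPartner hin v := fun _ => rfl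
  by_cases h : D.partner (capLeft hin) = capRight hin
  · have : D.mulGen i hi hin = D := ext_partner fun v => capPartner_eq_self D hin h v
    rw [this]; split_ifs <;> omega
  have hne := capLeft_ne_capRight hi hin
  have cL : ((capLeft hin : DVertex n).col : ℕ) = i - 1 := rfl
  have cR : ((capRight hin : DVertex n).col : ℕ) = i := rfl
  unfold crossing
  rw [← sub_le_iff_le_add', ← Finset.sum_sub_distrib]
  simp only [hF, capPartner]
  have inv := D.partner_partner
  have nef := D.partner_ne
  generalize D.partner = f at *
  generalize capLeft hin = a at *
  generalize capRight hin = b at *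
  have hba : f b ≠ a := fun e => h (by rw [← e, inv])
  have hfab : f a ≠ f b := fun e => hne (by rw [← inv a, e, inv])
  -- Only the ends of these arcs can contribute to the difference.
  rw [← Finset.sum_subset (Finset.subset_univ {a, b, f a, f b})]
  · rw [Finset.sum_insert (by simp [hne, (nef a).symm, hba.symm]),
      Finset.sum_insert (by simp [Ne.symm h, (nef b).symm]),
      Finset.sum_insert (by simp [hfab]), Finset.sum_singleton]
    simp only [if_true, if_neg hne.symm, if_neg h, if_neg (nef a), if_neg (nef b), if_neg hba,
      if_neg hfab.symm, inv]
    split_ifs <;> omega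
  · intro v _ hv
    simp only [Finset.mem_insert, Finset.mem_singleton, not_or] at hv
    rw [if_neg hv.1, if_neg hv.2.1, if_neg hv.2.2.1, if_neg hv.2.2.2, sub_self]

theorem mulGen_partner_of_ne (D : PlanarDiagram n) {i : ℕ} (hi : 0 < i) (hin : i < n)
    {v : DVertex n} (h1 : v ≠ capLeft hin) (h2 : v ≠ capRight hin) :
    (D.mulGen i hi hin).partner v = if v = D.partner (capLeft hin) then D.partner (capRight hin)
      else if v = D.partner (capRight hin) then D.partner (capLeft hin) else D.partner v := by
  simp only [mulGen, capPartner, if_neg h1, if_neg h2]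

/-- The hypotheses say that the arc of `a` leaves weakly to the left and that of `b` weakly to the
right. Then the rerouted arc still runs from left to right, so the only changes in the north come
from the new cap. -/
theorem northStep_mulGen (D : PlanarDiagram n) {i : ℕ} (hi : 0 < i) (hin : i < n)
    (hl : ((D.partner (capLeft hin)).col : ℕ) ≤ i - 1)
    (hr : i ≤ ((D.partner (capRight hin)).col : ℕ)) (k : ℕ) :
    (D.mulGen i hi hin).northStep k =
      if k + 1 = i then 1 else if k = i then 0 else D.northStep k := by
  have hF : ∀ v, (D.mulGen i hi hin).partner v = D.capPartner hin v := fun _ => rfl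
  by_cases h1 : k + 1 = i
  · obtain rfl : k = i - 1 := by omega
    have hk : i - 1 < n := by omega
    rw [if_pos h1, northStep, dif_pos hk, hF, capPartner, if_pos rfl, if_pos]
    simp only [DVertex.col, Fin.lt_def]; omega
  by_cases h2 : k = i
  · subst h2
    rw [if_neg h1, if_pos rfl, northStep, dif_pos hin, hF, capPartner,
      if_neg (capLeft_ne_capRight hi hin).symm, if_pos rfl, if_neg]
    simp only [DVertex.col, Fin.lt_def]; omega
  rw [if_neg h1, if_neg h2]
  unfold northStep
  by_cases hk : k < n
  swap
  · rw [dif_neg hk, dif_neg hk]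
  rw [dif_pos hk, dif_pos hk, mulGen_partner_of_ne D hi hin (by simp; omega) (by simp; omega)]
  have cL : ((capLeft hin : DVertex n).col : ℕ) = i - 1 := rfl
  have cR : ((capRight hin : DVertex n).col : ℕ) = i := rfl
  by_cases h3 : Sum.inl ⟨k, hk⟩ = D.partner (capLeft hin)
  · have h : k = ((D.partner (capLeft hin)).col : ℕ) :=
      congrArg (fun v => (DVertex.col v : ℕ)) h3
    rw [if_pos h3, if_pos, if_pos]
    · rw [h3, D.partner_partner, Fin.lt_def, cL]; show k < i - 1; omega
    · rw [Fin.lt_def]; show k < _; omega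
  rw [if_neg h3]
  by_cases h4 : Sum.inl ⟨k, hk⟩ = D.partner (capRight hin)
  · have h : k = ((D.partner (capRight hin)).col : ℕ) :=
      congrArg (fun v => (DVertex.col v : ℕ)) h4
    rw [if_pos h4, if_neg, if_neg]
    · rw [h4, D.partner_partner, Fin.lt_def, cR]; show ¬ k < i; omega
    · rw [Fin.lt_def]; show ¬ k < _; omega
  rw [if_neg h4]

/-- The rerouted arc preserves left and right ends in the south as well, except that a vertical arc
in column `i` becomes one with a right end there. A vertical arc in column `i - 1` becomes one with
a left end, which `southStep` does not distinguish. -/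
theorem southStep_mulGen (D : PlanarDiagram n) {i : ℕ} (hi : 0 < i) (hin : i < n)
    (hl : ((D.partner (capLeft hin)).col : ℕ) ≤ i - 1)
    (hr : i ≤ ((D.partner (capRight hin)).col : ℕ)) (k : ℕ) :
    (D.mulGen i hi hin).southStep k =
      if k = i ∧ D.partner (capRight hin) = Sum.inr ⟨i, hin⟩ then 1 else D.southStep k := by
  unfold southStep
  by_cases hk : k < n
  swap
  · rw [dif_neg hk, dif_neg hk, if_neg (by omega)]
  rw [dif_pos hk, dif_pos hk, mulGen_partner_of_ne D hi hin (by simp) (by simp)]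
  have cL : ((capLeft hin : DVertex n).col : ℕ) = i - 1 := rfl
  have cR : ((capRight hin : DVertex n).col : ℕ) = i := rfl
  by_cases h3 : Sum.inr ⟨k, hk⟩ = D.partner (capLeft hin)
  · have h : k = ((D.partner (capLeft hin)).col : ℕ) :=
      congrArg (fun v => (DVertex.col v : ℕ)) h3
    rw [if_pos h3, if_pos, if_neg (by omega), if_pos]
    · rw [h3, D.partner_partner, Fin.le_def, cL]; show k ≤ i - 1; omega
    · rw [Fin.le_def]; show k ≤ _; omega
  rw [if_neg h3]
  by_cases h4 : Sum.inr ⟨k, hk⟩ = D.partner (capRight hin)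
  · have h : k = ((D.partner (capRight hin)).col : ℕ) :=
      congrArg (fun v => (DVertex.col v : ℕ)) h4
    rw [if_pos h4, if_neg (by rw [Fin.le_def]; show ¬ k ≤ _; omega)]
    by_cases h5 : k = i
    · subst h5; rw [if_pos ⟨rfl, h4.symm⟩]
    · rw [if_neg (fun h => h5 h.1), if_neg]
      rw [h4, D.partner_partner, Fin.le_def, cR]; show ¬ k ≤ i; omega
  rw [if_neg h4, if_neg (c := _ ∧ _)]
  rintro ⟨rfl, h5⟩
  exact h4 h5.symm

end PlanarDiagram

/-! ### Boxes between lattice paths, and words read from them. -/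

/-- A sequence whose increments are `0` or `1`: the numbers of west steps of a lattice path with
unit steps to the south and to the west. -/
def IsLatticePath (p : ℤ → ℤ) : Prop := ∀ k, p k ≤ p (k + 1) ∧ p (k + 1) ≤ p k + 1

/-- The boxes between two lattice paths. -/
def boxesBetween (p q : ℤ → ℤ) : Set (ℤ × ℤ) :=
  {b | q (b.1 - b.2) ≤ -b.2 ∧ -b.2 < p (b.1 - b.2)}

theorem mem_boxesBetween {p q : ℤ → ℤ} {b : ℤ × ℤ} :
    b ∈ boxesBetween p q ↔ q (b.1 - b.2) ≤ -b.2 ∧ -b.2 < p (b.1 - b.2) := Iff.rfl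

theorem eq_of_boxesBetween_eq_empty {p q : ℤ → ℤ} (hqp : ∀ k, q k ≤ p k)
    (h : ∀ b, b ∉ boxesBetween p q) (k : ℤ) : p k = q k := by
  by_contra hc
  -- If `q k < p k`, the southeasternmost box of diagonal `k` lies between the paths.
  refine h (k - q k, - q k) ?_
  have := hqp k
  rw [mem_boxesBetween]
  simp only [sub_neg_eq_add, sub_add_cancel, neg_neg]
  omega

namespace PlanarDiagram

variable {n : ℕ}

theorem northStep_idDiagram (k : ℕ) : (idDiagram n).northStep k = 0 := by
  by_cases h : k < n
  · have := northStep_coe (idDiagram n) ⟨k, h⟩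
    simpa [idDiagram, DVertex.col] using this
  · exact northStep_of_le _ (by omega)

theorem southStep_idDiagram (k : ℕ) : (idDiagram n).southStep k = 0 := by
  by_cases h : k < n
  · have := southStep_coe (idDiagram n) ⟨k, h⟩
    simpa [idDiagram, DVertex.col] using this
  · exact southStep_of_le _ (by omega)

theorem northPath_idDiagram (k : ℤ) : (idDiagram n).northPath k = 0 := by
  simp [northPath, northStep_idDiagram]

theorem southPath_idDiagram (k : ℤ) : (idDiagram n).southPath k = 0 := by
  simp [southPath, southStep_idDiagram]

/-- When the two arcs under the cap leave in opposite directions, the generator adds exactly one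
box, on diagonal `i`. -/
theorem northPath_sub_southPath_mulGen (D : PlanarDiagram n) {i : ℕ} (hi : 0 < i) (hin : i < n)
    (hl : ((D.partner (capLeft hin)).col : ℕ) ≤ i - 1)
    (hr : i ≤ ((D.partner (capRight hin)).col : ℕ)) (k : ℕ) :
    (D.mulGen i hi hin).northPath k - (D.mulGen i hi hin).southPath k =
      D.northPath k - D.southPath k + if k = i then 1 else 0 := by
  have hL : D.northStep (i - 1) = 0 := by
    have hlt : i - 1 < n := by omega
    have := northStep_coe D ⟨i - 1, hlt⟩
    rw [this, if_neg]
    rw [Fin.lt_def]; show ¬ i - 1 < ((D.partner (capLeft hin)).col : ℕ); omega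
  -- Either the arc at column `i` is vertical, so both old steps are 0 and the new southern step is
  -- 1, or the northern vertex is a left end and the southern step does not change.
  have hR : D.northStep i - D.southStep i = 1 - (D.mulGen i hi hin).southStep i := by
    rw [southStep_mulGen D hi hin hl hr]
    by_cases h : D.partner (capRight hin) = Sum.inr ⟨i, hin⟩
    · rw [if_pos ⟨rfl, h⟩]
      have h1 := northStep_coe D ⟨i, hin⟩
      have h2 := southStep_coe D ⟨i, hin⟩
      simp only at h1 h2
      rw [h1, h2, D.partner_eq_comm.1 h, h]
      simp [DVertex.col]
    · rw [if_neg (fun h' => h h'.2)]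
      have h1 := northStep_coe D ⟨i, hin⟩
      have h2 : (D.partner (capRight hin)).col ≠ ⟨i, hin⟩ :=
        fun e => h (D.partner_inl_of_col_eq e)
      simp only at h1
      rw [h1, if_pos]
      rw [Ne, Fin.ext_iff] at h2
      have h3 : ((D.partner (capRight hin)).col : ℕ) ≠ i := h2
      rw [Fin.lt_def]; show i < ((D.partner (capRight hin)).col : ℕ); omega
  induction k with
  | zero =>
    simp only [Nat.cast_zero, northPath_of_nonpos _ le_rfl, southPath_of_nonpos _ le_rfl]
    rw [if_neg (by omega)]; rfl
  | succ k ih =>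
    push_cast
    simp only [northPath_natCast_succ, southPath_natCast_succ]
    rw [northStep_mulGen D hi hin hl hr]
    by_cases h1 : k + 1 = i
    · obtain rfl : k = i - 1 := by omega
      rw [southStep_mulGen D hi hin hl hr]
      rw [if_neg (by omega)] at ih
      rw [if_pos h1, if_pos h1, if_neg (by omega)]
      omega
    · by_cases h2 : k = i
      · subst h2
        rw [if_pos rfl] at ih
        rw [if_neg h1, if_neg h1, if_pos rfl]
        omega
      · rw [southStep_mulGen D hi hin hl hr]
        rw [if_neg h2] at ih
        rw [if_neg h1, if_neg h1, if_neg h2, if_neg (fun h => h2 h.1)]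
        omega

/-- A letter `i` enlarges only diagonal `i`, and by at most one box. This is the lower bound on the
length of words. -/
theorem northPath_sub_southPath_le_count {w : List ℕ} {L : ℕ} {d : PlanarDiagram n}
    (h : WordProduct w L d) (k : ℕ) : d.northPath k - d.southPath k ≤ w.count k := by
  induction h with
  | nil => simp [northPath_idDiagram, southPath_idDiagram]
  | @cons i w L M D E hi hin _ hp ih =>
    rw [hp.eq_mulGen]
    have h1 := crossing_mulGen_le D hi hin k
    rw [crossing_eq, crossing_eq] at h1
    rw [List.count_cons]
    push_cast
    simp only [beq_iff_eq]
    by_cases h : i = k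
    · rw [if_pos h.symm] at h1; rw [if_pos h]; omega
    · rw [if_neg (Ne.symm h)] at h1; rw [if_neg h]; omega

theorem isReducedExpression_of_count {w : List ℕ} {d : PlanarDiagram n} (h : WordProduct w 0 d)
    (hc : ∀ k : ℕ, (w.count k : ℤ) = d.northPath k - d.southPath k) :
    IsReducedExpression w d := by
  refine ⟨h, fun v L hv => ?_⟩
  have : w.Subperm v := by
    rw [List.subperm_iff_count]
    intro k
    have := northPath_sub_southPath_le_count hv k
    rw [← hc] at this
    exact_mod_cast this
  exact this.length_le

/-- A list that enumerates the boxes between two lattice paths compatibly with the product order is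
the list of labels of a reduced word, whose product has the same labels and the same relative
position of adjacent diagonals. -/
theorem exists_wordProduct (l : List (ℤ × ℤ)) (p q : ℤ → ℤ) (hnd : l.Nodup)
    (hord : l.Pairwise (fun x y => ¬ y ≤ x)) (hp : IsLatticePath p) (hq : IsLatticePath q)
    (hqp : ∀ k, q k ≤ p k) (hmem : ∀ b, b ∈ l ↔ b ∈ boxesBetween p q)
    (hlab : ∀ b ∈ l, 0 < boxLabel b ∧ boxLabel b < n) :
    ∃ d : PlanarDiagram n, WordProduct (l.map fun b => (boxLabel b).toNat) 0 d ∧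
      (∀ k, d.northPath k - d.southPath k = p k - q k) ∧
      (∀ k, q k < p k → q (k + 1) < p (k + 1) →
        d.northPath (k + 1) - d.northPath k = p (k + 1) - p k) ∧
      ∀ k : ℕ, ((l.map fun b => (boxLabel b).toNat).count k : ℤ) =
        d.northPath k - d.southPath k := by
  induction l generalizing p with
  | nil =>
    have h := eq_of_boxesBetween_eq_empty hqp (fun b hb => by simpa using (hmem b).2 hb)
    refine ⟨idDiagram n, WordProduct.nil, ?_, ?_, ?_⟩
    · intro k; rw [northPath_idDiagram, southPath_idDiagram, h]; omega
    · intro k hk; have := h k; omega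
    · intro k; simp [northPath_idDiagram, southPath_idDiagram]
  | cons b l ih =>
    obtain ⟨b1, b2⟩ := b
    have hb := (hmem (b1, b2)).1 List.mem_cons_self
    have hlb := hlab (b1, b2) List.mem_cons_self
    -- The first box of the list is minimal, so its northern and western neighbours, on diagonals `i
    -- - 1` and `i + 1`, are missing. Hence it is the first box of diagonal `i`, and the north path
    -- has a corner there: a west step into `i` and a south step out of it.
    have hmin : ∀ c, c ∈ boxesBetween p q → c ≤ (b1, b2) → c = (b1, b2) := by
      intro c hc hcb
      rcases List.mem_cons.1 ((hmem c).2 hc) with h | h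
      · exact h
      · exact absurd hcb ((List.pairwise_cons.1 hord).1 c h)
    have hN : (b1 - 1, b2) ∉ boxesBetween p q := fun h => by
      have := hmin _ h (by rw [Prod.mk_le_mk]; omega)
      rw [Prod.mk.injEq] at this; omega
    have hW : (b1, b2 - 1) ∉ boxesBetween p q := fun h => by
      have := hmin _ h (by rw [Prod.mk_le_mk]; omega)
      rw [Prod.mk.injEq] at this; omega
    obtain ⟨i, hik⟩ : ∃ i : ℕ, (i : ℤ) = b1 - b2 := ⟨(b1 - b2).toNat, by
      simp only [boxLabel] at hlb; omega⟩
    have hi : 0 < i := by simp only [boxLabel] at hlb; omega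
    have hin : i < n := by simp only [boxLabel] at hlb; omega
    simp only [mem_boxesBetween] at hb hN hW
    rw [← hik] at hb
    rw [show b1 - 1 - b2 = (i : ℤ) - 1 by omega] at hN
    rw [show b1 - (b2 - 1) = (i : ℤ) + 1 by omega] at hW
    have p1 := hp ((i : ℤ) - 1)
    have q1 := hq ((i : ℤ) - 1)
    have p2 := hp i
    have q2 := hq i
    rw [sub_add_cancel] at p1 q1
    -- Removing the box flips that corner. The tail of the list enumerates the boxes of the new
    -- region, and the head letter multiplies from the left, that is, on top.
    obtain ⟨d, hd1, hd2, hd3, hd4⟩ := ih (fun k => if k = i then p k - 1 else p k)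
      (List.nodup_cons.1 hnd).2 (List.pairwise_cons.1 hord).2
      (by
        intro k
        have := hp k
        beta_reduce
        by_cases h1 : k = i
        · subst h1; rw [if_pos rfl, if_neg (by omega)]; omega
        · by_cases h2 : k + 1 = i
          · obtain rfl : k = i - 1 := by omega
            rw [if_neg h1, if_pos h2, sub_add_cancel]; omega
          · rw [if_neg h1, if_neg h2]; omega)
      (by
        intro k
        have := hqp k
        split_ifs with h
        · subst h; omega
        · exact this)
      (by
        rintro ⟨c1, c2⟩
        have h1 := hmem (c1, c2)
        have h2 := (List.nodup_cons.1 hnd).1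
        rw [List.mem_cons] at h1
        have h3 : (c1, c2) ∈ l ↔ (c1, c2) ∈ boxesBetween p q ∧ (c1, c2) ≠ (b1, b2) := by
          rw [← h1]
          constructor
          · intro h; exact ⟨Or.inr h, fun e => h2 (e ▸ h)⟩
          · rintro ⟨h | h, h'⟩
            · exact absurd h h'
            · exact h
        rw [h3]
        simp only [mem_boxesBetween, ne_eq, Prod.mk.injEq]
        by_cases h4 : c1 - c2 = i
        · rw [h4, if_pos rfl]; omega
        · rw [if_neg h4]
          constructor
          · exact fun h => h.1
          · exact fun h => ⟨h, by omega⟩)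
      (fun c hc => hlab c (List.mem_cons_of_mem _ hc))
    have ri := hd2 i
    have rl := hd2 ((i : ℤ) - 1)
    have rr := hd2 ((i : ℤ) + 1)
    rw [if_pos rfl] at ri
    rw [if_neg (by omega)] at rl rr
    have sl := hd3 ((i : ℤ) - 1)
    have sr := hd3 (i : ℤ)
    rw [sub_add_cancel, if_pos rfl, if_neg (by omega)] at sl
    rw [if_pos rfl, if_neg (by omega)] at sr
    have nl := d.northPath_natCast_succ (i - 1)
    rw [show ((i - 1 : ℕ) : ℤ) = (i : ℤ) - 1 by omega, sub_add_cancel] at nl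
    have nr := d.northPath_natCast_succ i
    have cross := d.crossing_eq i
    -- If this arc went right, diagonal `i` would be nonempty in `d`, and so would diagonal `i - 1`.
    -- Then the north path of `d` must copy the flipped corner, which has no west step into `i`.
    have hl : ((d.partner (capLeft hin)).col : ℕ) ≤ i - 1 := by
      by_contra hc
      have hlt : i - 1 < n := by omega
      have h1 := northStep_coe d ⟨i - 1, hlt⟩
      rw [if_pos (by rw [Fin.lt_def]; show i - 1 < ((d.partner (capLeft hin)).col : ℕ); omega)] at h1
      simp only at h1
      have h2 : d.crossing i ≠ 0 := fun h => by
        have := (d.crossing_eq_zero_iff i).1 h (capLeft hin) (by show i - 1 < i; omega)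
        omega
      have h3 := d.crossing_nonneg i
      have := sl (by omega) (by omega)
      omega
    -- Symmetrically, if this arc went left, diagonals `i` and `i + 1` would be nonempty, and the
    -- flipped corner requires a west step out of `i`.
    have hr : i ≤ ((d.partner (capRight hin)).col : ℕ) := by
      by_contra hc
      have h1 := northStep_coe d ⟨i, hin⟩
      rw [if_neg (by rw [Fin.lt_def]; show ¬ i < ((d.partner (capRight hin)).col : ℕ); omega)] at h1
      simp only at h1
      have h2 : d.crossing i ≠ 0 := d.crossing_pos_of_right (v := capRight hin)
        (by rw [Fin.lt_def]; show ((d.partner (capRight hin)).col : ℕ) < i; omega)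
      have h3 := d.crossing_nonneg i
      have := sr (by omega) (by omega)
      omega
    have hloop : d.partner (capLeft hin) ≠ capRight hin := fun e => by
      rw [e] at hl
      have : i ≤ i - 1 := hl
      omega
    have hr' : ∀ k : ℕ, (d.mulGen i hi hin).northPath k - (d.mulGen i hi hin).southPath k =
        p k - q k := by
      intro k
      rw [northPath_sub_southPath_mulGen d hi hin hl hr, hd2]
      by_cases h : k = i
      · subst h; rw [if_pos rfl, if_pos rfl]; omega
      · rw [if_neg h, if_neg (by exact_mod_cast h)]; omega
    have hneg : ∀ k : ℤ, k ≤ 0 → p k - q k = 0 := by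
      intro k hk
      have := hd2 k
      rw [northPath_of_nonpos _ hk, southPath_of_nonpos _ hk, if_neg (by omega)] at this
      omega
    have hlabel : (boxLabel (b1, b2)).toNat = i := by simp only [boxLabel]; omega
    refine ⟨d.mulGen i hi hin, ?_, ?_, ?_, ?_⟩
    · rw [List.map_cons, hlabel]
      exact WordProduct.cons hi hin hd1 (isProduct_mulGen hi hin hloop)
    · intro k
      rcases le_total k 0 with h | h
      · rw [northPath_of_nonpos _ h, southPath_of_nonpos _ h, hneg k h]; rfl
      · lift k to ℕ using h
        exact hr' k
    · intro k h1 h2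
      have h : 0 ≤ k := by
        by_contra hc
        have := hneg k (by omega)
        omega
      lift k to ℕ using h
      rw [northPath_natCast_succ, northStep_mulGen d hi hin hl hr]
      by_cases e1 : k + 1 = i
      · rw [if_pos e1]
        obtain rfl : k = i - 1 := by omega
        rw [show ((i - 1 : ℕ) : ℤ) = (i : ℤ) - 1 by omega, sub_add_cancel]
        omega
      · by_cases e2 : k = i
        · subst e2; rw [if_neg e1, if_pos rfl]; omega
        · rw [if_neg e1, if_neg e2]
          have := hd3 k
          rw [if_neg (by exact_mod_cast e2), if_neg (by exact_mod_cast e1),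
            northPath_natCast_succ] at this
          have := this h1 h2
          omega
    · intro k
      rw [List.map_cons, hlabel, List.count_cons, northPath_sub_southPath_mulGen d hi hin hl hr]
      push_cast
      rw [hd4]
      simp only [beq_iff_eq, @eq_comm ℕ k i]

end PlanarDiagram

/-! ### Convex sets of boxes, skew shapes and lattice paths. -/

theorem IsLatticePath.le_of_le {p : ℤ → ℤ} (hp : IsLatticePath p) {k m : ℤ} (h : k ≤ m) :
    p k ≤ p m ∧ p m ≤ p k + (m - k) := by
  obtain ⟨j, rfl⟩ : ∃ j : ℕ, m = k + j := ⟨(m - k).toNat, by omega⟩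
  clear h
  induction j with
  | zero => simp
  | succ j ih =>
    have := hp (k + j)
    push_cast
    rw [← add_assoc]
    omega

/-- The set of boxes between two lattice paths is convex for the product order. -/
theorem boxesBetween_convex {p q : ℤ → ℤ} (hp : IsLatticePath p) (hq : IsLatticePath q)
    {x y z : ℤ × ℤ} (hx : x ∈ boxesBetween p q) (hz : z ∈ boxesBetween p q) (hxy : x ≤ y)
    (hyz : y ≤ z) : y ∈ boxesBetween p q := by
  obtain ⟨x1, x2⟩ := x
  obtain ⟨y1, y2⟩ := y
  obtain ⟨z1, z2⟩ := z
  rw [Prod.mk_le_mk] at hxy hyz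
  simp only [mem_boxesBetween] at *
  constructor
  · rcases le_total (y1 - y2) (z1 - z2) with h | h
    · have := hq.le_of_le h; omega
    · have := hq.le_of_le h; omega
  · rcases le_total (x1 - x2) (y1 - y2) with h | h
    · have := hp.le_of_le h; omega
    · have := hp.le_of_le h; omega

/-- A finite convex set of boxes is a skew shape. -/
theorem exists_isSkew_of_convex (S : Finset (ℤ × ℤ))
    (hS : ∀ x ∈ S, ∀ y, ∀ z ∈ S, x ≤ y → y ≤ z → y ∈ S) :
    ∃ (lam mu : YoungDiagram) (a b : ℤ), mu ≤ lam ∧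
      S = (lam.cells \ mu.cells).image (fun c => (a + (c.1 : ℤ), b + (c.2 : ℤ))) := by
  obtain ⟨⟨a, b⟩, hab⟩ : BddBelow (S : Set (ℤ × ℤ)) := S.finite_toSet.bddBelow
  have hab' : ∀ s ∈ S, a ≤ s.1 ∧ b ≤ s.2 := fun s hs => hab hs
  -- The lower set generated by `S`, measured from a lower bound `(a, b)`.
  let cells : Finset (ℕ × ℕ) := S.biUnion fun s =>
    Finset.range ((s.1 - a).toNat + 1) ×ˢ Finset.range ((s.2 - b).toNat + 1)
  have hcells : ∀ c : ℕ × ℕ, c ∈ cells ↔ ∃ s ∈ S, (a + (c.1 : ℤ), b + (c.2 : ℤ)) ≤ s := by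
    rintro ⟨c1, c2⟩
    simp only [cells, Finset.mem_biUnion, Finset.mem_product, Finset.mem_range]
    refine exists_congr fun s => and_congr_right fun hs => ?_
    have := hab' s hs
    rw [Prod.le_def]
    simp only
    omega
  let lam : YoungDiagram := ⟨cells, by
    rintro c c' hcc' hc
    rw [Finset.mem_coe, hcells] at hc ⊢
    obtain ⟨s, hs, hle⟩ := hc
    refine ⟨s, hs, le_trans ?_ hle⟩
    rw [Prod.le_def] at hcc' ⊢
    simp only
    omega⟩
  -- Convexity of `S` is what makes the complement of `S` in `lam` a lower set.
  let mu : YoungDiagram := ⟨cells.filter fun c => (a + (c.1 : ℤ), b + (c.2 : ℤ)) ∉ S, by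
    rintro c c' hcc' hc
    rw [Finset.mem_coe, Finset.mem_filter] at hc ⊢
    refine ⟨lam.isLowerSet hcc' hc.1, fun h => hc.2 ?_⟩
    obtain ⟨s, hs, hle⟩ := (hcells _).1 hc.1
    refine hS _ h _ _ hs ?_ hle
    rw [Prod.le_def] at hcc' ⊢
    simp only
    omega⟩
  refine ⟨lam, mu, a, b, fun c hc => (Finset.mem_filter.1 hc).1, ?_⟩
  ext ⟨x, y⟩
  simp only [Finset.mem_image, Finset.mem_sdiff, lam, mu, Finset.mem_filter, not_and, not_not]
  constructor
  · intro h
    have := hab' _ h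
    have e : ((a + (((x - a).toNat : ℕ) : ℤ), b + (((y - b).toNat : ℕ) : ℤ)) : ℤ × ℤ) = (x, y) := by
      rw [Prod.mk.injEq]; simp only at this; omega
    refine ⟨((x - a).toNat, (y - b).toNat), ⟨(hcells _).2 ⟨(x, y), h, le_of_eq e⟩, fun _ => ?_⟩, e⟩
    simp only [e]
    exact h
  · rintro ⟨c, ⟨h1, h2⟩, h3⟩
    rw [← h3]
    exact h2 h1

/-- The labeled skew shape on a finite convex set of boxes with positive labels. -/
def LabeledSkewShape.ofConvex (S : Finset (ℤ × ℤ))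
    (hS : ∀ x ∈ S, ∀ y, ∀ z ∈ S, x ≤ y → y ≤ z → y ∈ S) (hpos : ∀ b ∈ S, 0 < boxLabel b) :
    LabeledSkewShape :=
  ⟨S, exists_isSkew_of_convex S hS, hpos⟩

/-- Every finite convex set of boxes is the set of boxes between two lattice paths. -/
theorem exists_latticePaths (S : Finset (ℤ × ℤ))
    (hS : ∀ x ∈ S, ∀ y, ∀ z ∈ S, x ≤ y → y ≤ z → y ∈ S) :
    ∃ p q : ℤ → ℤ, IsLatticePath p ∧ IsLatticePath q ∧ (∀ k, q k ≤ p k) ∧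
      ∀ b, b ∈ S ↔ b ∈ boxesBetween p q := by
  rcases S.eq_empty_or_nonempty with rfl | hne
  · refine ⟨fun _ => 0, fun _ => 0, fun k => by simp, fun k => by simp, fun k => le_rfl, ?_⟩
    intro b
    simp [mem_boxesBetween]
  -- These are chosen so that `w < P k` says that the box `(k - w, -w)` lies weakly southeast of a
  -- box of `S`, and `Q k ≤ w` that it lies weakly northwest of one. By convexity both together mean
  -- membership in `S`.
  let P : ℤ → ℤ := fun k => S.sup' hne (fun s => min (k - s.1) (-s.2)) + 1
  let Q : ℤ → ℤ := fun k => S.inf' hne (fun s => max (k - s.1) (-s.2))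
  have hP : ∀ k w, w < P k ↔ ∃ s ∈ S, w ≤ k - s.1 ∧ w ≤ -s.2 := by
    intro k w
    simp only [P, Int.lt_add_one_iff, Finset.le_sup'_iff, le_min_iff]
  have hQ : ∀ k w, Q k ≤ w ↔ ∃ s ∈ S, k - s.1 ≤ w ∧ -s.2 ≤ w := by
    intro k w
    simp only [Q, Finset.inf'_le_iff, max_le_iff]
  have hPl : IsLatticePath P := by
    intro k
    constructor
    · by_contra hc
      obtain ⟨s, hs, h1, h2⟩ := (hP k (P (k + 1))).1 (by omega)
      have := (hP (k + 1) (P (k + 1))).2 ⟨s, hs, by omega, by omega⟩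
      omega
    · by_contra hc
      obtain ⟨s, hs, h1, h2⟩ := (hP (k + 1) (P k + 1)).1 (by omega)
      have := (hP k (P k)).2 ⟨s, hs, by omega, by omega⟩
      omega
  have hQl : IsLatticePath Q := by
    intro k
    constructor
    · obtain ⟨s, hs, h1, h2⟩ := (hQ (k + 1) (Q (k + 1))).1 le_rfl
      exact (hQ k (Q (k + 1))).2 ⟨s, hs, by omega, by omega⟩
    · obtain ⟨s, hs, h1, h2⟩ := (hQ k (Q k)).1 le_rfl
      exact (hQ (k + 1) (Q k + 1)).2 ⟨s, hs, by omega, by omega⟩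
  -- The minimum enforces `q ≤ p`; it alters `Q` only on diagonals without boxes.
  refine ⟨P, fun k => min (Q k) (P k), hPl, ?_, fun k => min_le_right _ _, ?_⟩
  · intro k
    have := hPl k
    have := hQl k
    beta_reduce
    omega
  · rintro ⟨b1, b2⟩
    rw [mem_boxesBetween]
    simp only
    constructor
    · intro h
      have h1 := (hP (b1 - b2) (-b2)).2 ⟨_, h, by simp only; omega, le_rfl⟩
      have h2 := (hQ (b1 - b2) (-b2)).2 ⟨_, h, by simp only; omega, le_rfl⟩
      omega
    · rintro ⟨h1, h2⟩
      obtain ⟨s, hs, hs1, hs2⟩ := (hP _ _).1 h2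
      obtain ⟨t, ht, ht1, ht2⟩ := (hQ (b1 - b2) (-b2)).1 (by omega)
      refine hS s hs _ t ht ?_ ?_ <;> rw [Prod.le_def] <;> simp only <;> omega

/-! ### BJS-equivalence in terms of diagonals. -/

/-- Two labeled skew shapes between lattice paths are BJS-equivalent if their diagonals have the
same lengths and the same relative positions. -/
theorem BJSEquiv.of_latticePaths {S T : LabeledSkewShape} {p q p' q' : ℤ → ℤ}
    (hS : ∀ b, b ∈ S.boxes ↔ b ∈ boxesBetween p q) (hT : ∀ b, b ∈ T.boxes ↔ b ∈ boxesBetween p' q')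
    (h1 : ∀ k, p' k - q' k = p k - q k)
    (h2 : ∀ k, q k < p k → q (k + 1) < p (k + 1) → p' (k + 1) - p' k = p (k + 1) - p k) :
    BJSEquiv S T := by
  -- Each diagonal is translated along itself by `s k`. The hypothesis `h2` makes `s` constant
  -- across adjacent nonempty diagonals, so covering relations are preserved, and convexity connects
  -- comparable boxes by such relations.
  let s : ℤ → ℤ := fun k => p' k - p k
  have hs : ∀ k, s k = p' k - p k := fun _ => rfl
  let F : ℤ × ℤ → ℤ × ℤ := fun b => (b.1 - s (b.1 - b.2), b.2 - s (b.1 - b.2))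
  have hmem : ∀ b ∈ S.boxes, F b ∈ T.boxes := by
    rintro ⟨x, y⟩ hb
    rw [hS, mem_boxesBetween] at hb
    rw [hT, mem_boxesBetween]
    simp only [F] at *
    rw [sub_sub_sub_cancel_right]
    have := h1 (x - y)
    have := hs (x - y)
    omega
  have hstep : ∀ x y : ℤ, ∀ x' y', (x, y) ∈ S.boxes → (x', y') ∈ S.boxes →
      (x' - y' = x - y + 1 ∨ x' - y' = x - y - 1) → s (x - y) = s (x' - y') := by
    intro x y x' y' hb hb' h
    rw [hS, mem_boxesBetween] at hb hb'
    simp only at hb hb'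
    rw [hs, hs]
    rcases h with h | h
    · rw [h] at hb' ⊢
      have := h2 (x - y) (by omega) (by omega)
      omega
    · have e : x - y = x' - y' + 1 := by omega
      rw [e] at hb ⊢
      have := h2 (x' - y') (by omega) (by omega)
      omega
  refine ⟨fun b => ⟨F b, hmem _ b.2⟩, ⟨?_, ?_⟩, ?_, ?_⟩
  · rintro ⟨⟨x, y⟩, hb⟩ ⟨⟨x', y'⟩, hb'⟩ h
    simp only [F, Subtype.mk.injEq, Prod.mk.injEq] at h ⊢
    have : x - y = x' - y' := by omega
    rw [this] at h
    omega
  · rintro ⟨⟨x, y⟩, hb⟩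
    have hb' := (hT _).1 hb
    rw [mem_boxesBetween] at hb'
    have e : x + s (x - y) - (y + s (x - y)) = x - y := by ring
    refine ⟨⟨(x + s (x - y), y + s (x - y)), ?_⟩, ?_⟩
    · rw [hS, mem_boxesBetween]
      simp only at *
      rw [e]
      have := h1 (x - y)
      have := hs (x - y)
      omega
    · simp only [F, Subtype.mk.injEq, Prod.mk.injEq, e]
      omega
  · have main : ∀ (m : ℕ) (x y x' y' : ℤ), (x, y) ∈ S.boxes → (x', y') ∈ S.boxes → x ≤ x' →
        y ≤ y' → (x' - x) + (y' - y) = m → F (x, y) ≤ F (x', y') := by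
      intro m
      induction m with
      | zero =>
        intro x y x' y' _ _ hx hy hm
        obtain rfl : x = x' := by push_cast at hm; omega
        obtain rfl : y = y' := by push_cast at hm; omega
        exact le_rfl
      | succ m ih =>
        intro x y x' y' hb hb' hx hy hm
        push_cast at hm
        by_cases hlt : x < x'
        · have hz : (x + 1, y) ∈ S.boxes :=
            S.convex hb hb' (by rw [Prod.mk_le_mk]; omega) (by rw [Prod.mk_le_mk]; omega)
          refine le_trans ?_ (ih (x + 1) y x' y' hz hb' (by omega) hy (by omega))
          have := hstep x y (x + 1) y hb hz (by omega)
          simp only [F, Prod.mk_le_mk]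
          omega
        · have hz : (x, y + 1) ∈ S.boxes :=
            S.convex hb hb' (by rw [Prod.mk_le_mk]; omega) (by rw [Prod.mk_le_mk]; omega)
          refine le_trans ?_ (ih x (y + 1) x' y' hz hb' hx (by omega) (by omega))
          have := hstep x y x (y + 1) hb hz (by omega)
          simp only [F, Prod.mk_le_mk]
          omega
    rintro ⟨⟨x, y⟩, hb⟩ ⟨⟨x', y'⟩, hb'⟩ h
    have h' : (x, y) ≤ (x', y') := h
    rw [Prod.mk_le_mk] at h'
    exact main ((x' - x) + (y' - y)).toNat x y x' y' hb hb' h'.1 h'.2 (by omega)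
  · rintro ⟨⟨x, y⟩, hb⟩
    simp only [F, boxLabel]
    omega

/-- A BJS-equivalence preserves the number of boxes on each diagonal. -/
theorem BJSEquiv.length_diagonal {S T : LabeledSkewShape} (h : BJSEquiv S T) {p q p' q' : ℤ → ℤ}
    (hS : ∀ b, b ∈ S.boxes ↔ b ∈ boxesBetween p q) (hT : ∀ b, b ∈ T.boxes ↔ b ∈ boxesBetween p' q')
    (hqp : ∀ k, q k ≤ p k) (hqp' : ∀ k, q' k ≤ p' k) (k : ℤ) : p k - q k = p' k - q' k := by
  have card : ∀ (S : LabeledSkewShape) (p q : ℤ → ℤ),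
      (∀ b, b ∈ S.boxes ↔ b ∈ boxesBetween p q) → q k ≤ p k →
      ((S.boxes.filter fun b => boxLabel b = k).card : ℤ) = p k - q k := by
    intro S p q hS hqp
    have : S.boxes.filter (fun b => boxLabel b = k) =
        (Finset.Ico (q k) (p k)).image fun w => (k - w, -w) := by
      ext ⟨x, y⟩
      rw [Finset.mem_filter]
      simp only [Finset.mem_image, Finset.mem_Ico, hS, mem_boxesBetween, boxLabel, Prod.mk.injEq]
      constructor
      · rintro ⟨h1, h2⟩
        rw [h2] at h1
        exact ⟨-y, h1, by omega, by omega⟩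
      · rintro ⟨w, h1, h2, h3⟩
        have e : x - y = k := by omega
        rw [e]
        omega
    rw [this, Finset.card_image_of_injective, Int.card_Ico]
    · omega
    · intro a b hab
      rw [Prod.mk.injEq] at hab
      omega
  rw [← card S p q hS (hqp k), ← card T p' q' hT (hqp' k), Nat.cast_inj]
  obtain ⟨f, hf, -, lf⟩ := h
  refine Finset.card_bij (fun b hb => (f ⟨b, (Finset.mem_filter.1 hb).1⟩ : ℤ × ℤ)) ?_ ?_ ?_
  · intro b hb
    rw [Finset.mem_filter] at hb ⊢
    exact ⟨Subtype.coe_prop _, by rw [lf]; exact hb.2⟩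
  · intro b hb c hc h
    have := hf.1 (Subtype.ext h)
    exact congrArg Subtype.val this
  · intro b hb
    rw [Finset.mem_filter] at hb
    obtain ⟨c, hc⟩ := hf.2 ⟨b, hb.1⟩
    refine ⟨c, Finset.mem_filter.2 ⟨c.2, ?_⟩, ?_⟩
    · rw [← lf, hc]; exact hb.2
    · simp only [Subtype.coe_eta, hc]

/-- A BJS-equivalence preserves the relative position of adjacent nonempty diagonals. -/
theorem BJSEquiv.step_le {S T : LabeledSkewShape} (h : BJSEquiv S T) {p q p' q' : ℤ → ℤ}
    (hS : ∀ b, b ∈ S.boxes ↔ b ∈ boxesBetween p q) (hT : ∀ b, b ∈ T.boxes ↔ b ∈ boxesBetween p' q')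
    (hp : IsLatticePath p) (hp' : IsLatticePath p') (hqp : ∀ k, q k ≤ p k)
    (hqp' : ∀ k, q' k ≤ p' k) {k : ℤ} (h0 : q k < p k) (h1 : q (k + 1) < p (k + 1)) :
    p (k + 1) - p k ≤ p' (k + 1) - p' k := by
  have len := h.length_diagonal hS hT hqp hqp'
  obtain ⟨f, hf, mf, lf⟩ := h
  -- A diagonal is a chain, so a monotone bijection matches the northwesternmost boxes of
  -- corresponding diagonals.
  have top : ∀ m, q m < p m → ∃ hm : (m - (p m - 1), -(p m - 1)) ∈ S.boxes,
      (f ⟨_, hm⟩ : ℤ × ℤ) = (m - (p' m - 1), -(p' m - 1)) := by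
    intro m hm
    have hb : (m - (p m - 1), -(p m - 1)) ∈ S.boxes := by
      rw [hS, mem_boxesBetween]
      simp only
      rw [show m - (p m - 1) - -(p m - 1) = m by ring]
      omega
    have hb' : (m - (p' m - 1), -(p' m - 1)) ∈ T.boxes := by
      have := len m
      rw [hT, mem_boxesBetween]
      simp only
      rw [show m - (p' m - 1) - -(p' m - 1) = m by ring]
      omega
    refine ⟨hb, ?_⟩
    obtain ⟨⟨⟨x, y⟩, hc⟩, hfc⟩ := hf.2 ⟨_, hb'⟩
    have l1 := lf ⟨(x, y), hc⟩
    rw [hfc] at l1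
    have hcS := (hS _).1 hc
    rw [mem_boxesBetween] at hcS
    simp only [boxLabel] at l1 hcS
    have e : x - y = m := by omega
    rw [e] at hcS
    have hle : (⟨_, hb⟩ : S.boxes) ≤ ⟨(x, y), hc⟩ := by
      rw [Subtype.mk_le_mk, Prod.mk_le_mk]; omega
    have h2 := mf hle
    rw [hfc] at h2
    have l2 := lf ⟨_, hb⟩
    have hT2 := (hT _).1 (f ⟨_, hb⟩).2
    generalize ((f ⟨_, hb⟩ : T.boxes)) = u at *
    obtain ⟨⟨u1, u2⟩, hu⟩ := u
    rw [Subtype.mk_le_mk, Prod.mk_le_mk] at h2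
    rw [mem_boxesBetween] at hT2
    simp only [boxLabel] at l2 hT2
    have e2 : u1 - u2 = m := by omega
    rw [e2] at hT2
    rw [Prod.mk.injEq]
    omega
  obtain ⟨a1, a2⟩ := top k h0
  obtain ⟨b1, b2⟩ := top (k + 1) h1
  have := hp k
  have := hp' k
  -- The only possible failure is a west step of `p` opposite a south step of `p'`. Then the first
  -- box of diagonal `k + 1` lies directly west of that of diagonal `k` in `S`, but directly south
  -- of it in `T`.
  by_contra hc
  have hle : (⟨_, b1⟩ : S.boxes) ≤ ⟨_, a1⟩ := by
    rw [Subtype.mk_le_mk, Prod.mk_le_mk]; omega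
  have h3 : (f ⟨_, b1⟩ : ℤ × ℤ) ≤ f ⟨_, a1⟩ := mf hle
  rw [a2, b2, Prod.mk_le_mk] at h3
  omega

/-! ### Reading words and their invariance under BJS-equivalence. -/

/-- The order of the boxes in the row reading word. -/
def RowLT (x y : ℤ × ℤ) : Prop := x.1 < y.1 ∨ x.1 = y.1 ∧ x.2 < y.2

/-- The order of the boxes in the column reading word. -/
def ColLT (x y : ℤ × ℤ) : Prop := x.2 < y.2 ∨ x.2 = y.2 ∧ x.1 < y.1

/-- The labels of a list of boxes. -/
def labelWord (l : List (ℤ × ℤ)) : List ℕ := l.map fun b => (boxLabel b).toNat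

theorem RowLT.not_ge {x y : ℤ × ℤ} (h : RowLT x y) : ¬ y ≤ x := by
  unfold RowLT at h
  rw [Prod.le_def]
  omega

theorem ColLT.not_ge {x y : ℤ × ℤ} (h : ColLT x y) : ¬ y ≤ x := by
  unfold ColLT at h
  rw [Prod.le_def]
  omega

theorem nodup_of_pairwise_not_ge {l : List (ℤ × ℤ)} (h : l.Pairwise fun x y => ¬ y ≤ x) :
    l.Nodup :=
  h.imp fun hxy => fun e => hxy (le_of_eq e.symm)

namespace LabeledSkewShape

theorem rowWord_eq {S : LabeledSkewShape} {l : List (ℤ × ℤ)} (hmem : ∀ b, b ∈ l ↔ b ∈ S.boxes)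
    (hl : l.Pairwise RowLT) : S.rowWord = labelWord l := by
  have h : (S.boxes.image (fun b => toLex (b.1, b.2))).sort (· ≤ ·) = l.map toLex := by
    have e : S.boxes.image (fun b => toLex (b.1, b.2)) = (l.map toLex).toFinset := by
      ext c
      simp [← hmem]
    rw [e]
    refine (List.toFinset_sort _ ?_).2 ?_
    · exact (nodup_of_pairwise_not_ge (hl.imp RowLT.not_ge)).map toLex.injective
    · rw [List.pairwise_map]
      refine hl.imp fun h => ?_
      rw [Prod.Lex.toLex_le_toLex]
      exact h.imp id fun h => ⟨h.1, h.2.le⟩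
  rw [rowWord, h, List.map_map]
  rfl

theorem colWord_eq {S : LabeledSkewShape} {l : List (ℤ × ℤ)} (hmem : ∀ b, b ∈ l ↔ b ∈ S.boxes)
    (hl : l.Pairwise ColLT) : S.colWord = labelWord l := by
  have h : (S.boxes.image (fun b => toLex (b.2, b.1))).sort (· ≤ ·) =
      l.map (fun b => toLex (b.2, b.1)) := by
    have e : S.boxes.image (fun b => toLex (b.2, b.1)) =
        (l.map (fun b => toLex (b.2, b.1))).toFinset := by
      ext c
      simp [← hmem]
    rw [e]
    refine (List.toFinset_sort _ ?_).2 ?_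
    · refine (nodup_of_pairwise_not_ge (hl.imp ColLT.not_ge)).map ?_
      rintro ⟨x1, x2⟩ ⟨y1, y2⟩ h
      simp only [EmbeddingLike.apply_eq_iff_eq, Prod.mk.injEq] at h ⊢
      exact h.symm
    · rw [List.pairwise_map]
      refine hl.imp fun h => ?_
      rw [Prod.Lex.toLex_le_toLex]
      exact h.imp id fun h => ⟨h.1, h.2.le⟩
  rw [colWord, h, List.map_map]
  rfl

theorem exists_rowList (S : LabeledSkewShape) :
    ∃ l : List (ℤ × ℤ), (∀ b, b ∈ l ↔ b ∈ S.boxes) ∧ l.Pairwise RowLT := by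
  refine ⟨((S.boxes.image (fun b => toLex (b.1, b.2))).sort (· ≤ ·)).map ofLex, ?_, ?_⟩
  · intro b
    simp only [List.mem_map, Finset.mem_sort, Finset.mem_image]
    constructor
    · rintro ⟨_, ⟨c, hc, rfl⟩, rfl⟩; exact hc
    · intro h; exact ⟨_, ⟨b, h, rfl⟩, rfl⟩
  · rw [List.pairwise_map]
    refine (Finset.sortedLT_sort _).pairwise.imp fun {x y} h => ?_
    rwa [Prod.Lex.lt_iff] at h

theorem exists_colList (S : LabeledSkewShape) :
    ∃ l : List (ℤ × ℤ), (∀ b, b ∈ l ↔ b ∈ S.boxes) ∧ l.Pairwise ColLT := by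
  refine ⟨((S.boxes.image (fun b => toLex (b.2, b.1))).sort (· ≤ ·)).map
    (fun c => (ofLex c).swap), ?_, ?_⟩
  · intro b
    simp only [List.mem_map, Finset.mem_sort, Finset.mem_image]
    constructor
    · rintro ⟨_, ⟨c, hc, rfl⟩, rfl⟩; exact hc
    · intro h; exact ⟨_, ⟨b, h, rfl⟩, rfl⟩
  · rw [List.pairwise_map]
    refine (Finset.sortedLT_sort _).pairwise.imp fun {x y} h => ?_
    rwa [Prod.Lex.lt_iff] at h

/-- A monotone label-preserving self-bijection is the identity. -/
theorem eq_id_of_monotone (S : LabeledSkewShape) (f : S.boxes → S.boxes)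
    (hf : Function.Bijective f) (mf : Monotone f)
    (lf : ∀ b : S.boxes, boxLabel (f b : ℤ × ℤ) = boxLabel (b : ℤ × ℤ)) (b : S.boxes) :
    f b = b := by
  -- Some iterate of `f` is the identity. Boxes with equal labels are comparable, so the iterates of
  -- `b` form a monotone sequence that returns to `b`, and it must be constant.
  obtain ⟨N, hN, hfN⟩ := isOfFinOrder_iff_pow_eq_one.1
    (isOfFinOrder_of_finite (Equiv.ofBijective f hf))
  have hit : f^[N] b = b := by
    have := congrArg (fun e : Equiv.Perm S.boxes => e b) hfN
    rwa [Equiv.Perm.coe_pow] at this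
  have hcmp : b ≤ f b ∨ f b ≤ b := by
    have := lf b
    generalize f b = c at *
    obtain ⟨⟨b1, b2⟩, hb⟩ := b
    obtain ⟨⟨c1, c2⟩, hc⟩ := c
    simp only [boxLabel, Subtype.mk_le_mk, Prod.mk_le_mk] at this ⊢
    omega
  rcases hcmp with h | h
  · have h1 := mf.monotone_iterate_of_le_map h (show 1 ≤ N from hN)
    beta_reduce at h1
    rw [hit] at h1
    exact le_antisymm h1 h
  · have h1 := mf.antitone_iterate_of_map_le h (show 1 ≤ N from hN)
    beta_reduce at h1
    rw [hit] at h1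
    exact le_antisymm h h1

end LabeledSkewShape

/-- A BJS-equivalence can be extended to a map on all boxes that reflects the order. -/
theorem BJSEquiv.exists_orderEmbedding {S T : LabeledSkewShape} (h : BJSEquiv S T) :
    ∃ g : ℤ × ℤ → ℤ × ℤ, (∀ c, (∃ b ∈ S.boxes, g b = c) ↔ c ∈ T.boxes) ∧
      (∀ b ∈ S.boxes, boxLabel (g b) = boxLabel b) ∧
      ∀ b ∈ S.boxes, ∀ c ∈ S.boxes, g b ≤ g c ↔ b ≤ c := by
  obtain ⟨g, hg, mg, lg⟩ := h.symm
  obtain ⟨f, hf, mf, lf⟩ := h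
  -- A monotone left inverse of `f` shows that `f` reflects the order.
  have hid := S.eq_id_of_monotone (g ∘ f) (hg.comp hf) (mg.comp mf)
    (fun b => (lg (f b)).trans (lf b))
  obtain ⟨G, hG⟩ : ∃ G : ℤ × ℤ → ℤ × ℤ, ∀ b, (hb : b ∈ S.boxes) → G b = f ⟨b, hb⟩ :=
    ⟨fun b => if h : b ∈ S.boxes then f ⟨b, h⟩ else b, fun b hb => dif_pos hb⟩
  refine ⟨G, ?_, ?_, ?_⟩
  · intro c
    constructor
    · rintro ⟨b, hb, rfl⟩
      rw [hG b hb]; exact (f ⟨b, hb⟩).2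
    · intro hc
      obtain ⟨b, hb⟩ := hf.2 ⟨c, hc⟩
      exact ⟨b, b.2, by rw [hG b b.2, Subtype.coe_eta, hb]⟩
  · intro b hb
    rw [hG b hb, lf]
  · intro b hb c hc
    rw [hG b hb, hG c hc]
    constructor
    · intro h
      have h2 : g (f ⟨b, hb⟩) ≤ g (f ⟨c, hc⟩) := mg h
      have e1 := hid ⟨b, hb⟩
      have e2 := hid ⟨c, hc⟩
      rw [Function.comp_apply] at e1 e2
      rw [e1, e2] at h2
      exact h2
    · intro h
      exact mf (show (⟨b, hb⟩ : S.boxes) ≤ ⟨c, hc⟩ from h)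

/-- The row reading word only depends on the BJS-equivalence class. -/
theorem BJSEquiv.rowWord_eq {S T : LabeledSkewShape} (h : BJSEquiv S T) :
    S.rowWord = T.rowWord := by
  obtain ⟨g, gmem, glab, gle⟩ := h.exists_orderEmbedding
  obtain ⟨l, hmem, hl⟩ := S.exists_rowList
  rw [S.rowWord_eq hmem hl, T.rowWord_eq (l := l.map g)]
  · rw [labelWord, labelWord, List.map_map]
    refine List.map_congr_left fun b hb => ?_
    rw [Function.comp_apply, glab b ((hmem b).1 hb)]
  · intro c
    simp only [List.mem_map, hmem, gmem]
  · rw [List.pairwise_map]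
    refine hl.imp_of_mem fun {x y} hx hy hxy => ?_
    rw [hmem] at hx hy
    -- The row order is recovered from invariants: comparable boxes are read in the product order,
    -- and of two incomparable boxes the northern one has the smaller label.
    have h1 := gle x hx y hy
    have h2 := gle y hy x hx
    have h3 := glab x hx
    have h4 := glab y hy
    simp only [RowLT, boxLabel, Prod.le_def] at *
    omega

/-- The column reading word only depends on the BJS-equivalence class. -/
theorem BJSEquiv.colWord_eq {S T : LabeledSkewShape} (h : BJSEquiv S T) :
    S.colWord = T.colWord := by
  obtain ⟨g, gmem, glab, gle⟩ := h.exists_orderEmbedding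
  obtain ⟨l, hmem, hl⟩ := S.exists_colList
  rw [S.colWord_eq hmem hl, T.colWord_eq (l := l.map g)]
  · rw [labelWord, labelWord, List.map_map]
    refine List.map_congr_left fun b hb => ?_
    rw [Function.comp_apply, glab b ((hmem b).1 hb)]
  · intro c
    simp only [List.mem_map, hmem, gmem]
  · rw [List.pairwise_map]
    refine hl.imp_of_mem fun {x y} hx hy hxy => ?_
    rw [hmem] at hx hy
    -- As for rows, except that of two incomparable boxes the western one, read first, has the
    -- larger label.
    have h1 := gle x hx y hy
    have h2 := gle y hy x hx
    have h3 := glab x hx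
    have h4 := glab y hy
    simp only [ColLT, boxLabel, Prod.le_def] at *
    omega

/-! ### The shape of a diagram and the correspondence with BJS-classes. -/

namespace PlanarDiagram

variable {n : ℕ}

theorem isLatticePath_northPath (d : PlanarDiagram n) : IsLatticePath d.northPath := by
  intro k
  rcases lt_or_ge k 0 with h | h
  · rw [northPath_of_nonpos _ h.le, northPath_of_nonpos _ (by omega)]; omega
  · lift k to ℕ using h
    rw [northPath_natCast_succ]
    rcases d.northStep_mem k with h | h <;> rw [h] <;> omega

theorem isLatticePath_southPath (d : PlanarDiagram n) : IsLatticePath d.southPath := by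
  intro k
  rcases lt_or_ge k 0 with h | h
  · rw [southPath_of_nonpos _ h.le, southPath_of_nonpos _ (by omega)]; omega
  · lift k to ℕ using h
    rw [southPath_natCast_succ]
    rcases d.southStep_mem k with h | h <;> rw [h] <;> omega

theorem label_of_mem_boxesBetween (d : PlanarDiagram n) {b : ℤ × ℤ}
    (h : b ∈ boxesBetween d.northPath d.southPath) : 0 < boxLabel b ∧ boxLabel b < n := by
  rw [mem_boxesBetween] at h
  by_contra hc
  have := d.southPath_eq_northPath (k := b.1 - b.2) (by simp only [boxLabel] at hc; omega)
  omega

theorem boxesBetween_finite (d : PlanarDiagram n) :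
    (boxesBetween d.northPath d.southPath).Finite := by
  refine (((Finset.Icc (-(n : ℤ)) n) ×ˢ (Finset.Icc (-(n : ℤ)) n)).finite_toSet).subset ?_
  rintro ⟨x, y⟩ h
  have hl := d.label_of_mem_boxesBetween h
  rw [mem_boxesBetween] at h
  simp only [boxLabel] at hl h
  have h1 := d.isLatticePath_northPath.le_of_le hl.1.le
  have h2 := d.isLatticePath_southPath.le_of_le hl.1.le
  rw [northPath_of_nonpos _ le_rfl] at h1
  rw [southPath_of_nonpos _ le_rfl] at h2
  simp only [Finset.coe_product, Finset.coe_Icc, Set.mem_prod, Set.mem_Icc]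
  omega

/-- The labeled skew shape of a diagram: the boxes between its two lattice paths. -/
noncomputable def shape (d : PlanarDiagram n) : BoundedSkewShape n :=
  ⟨LabeledSkewShape.ofConvex d.boxesBetween_finite.toFinset
    (by
      intro x hx y z hz hxy hyz
      rw [Set.Finite.mem_toFinset] at *
      exact boxesBetween_convex d.isLatticePath_northPath d.isLatticePath_southPath hx hz hxy hyz)
    (by
      intro b hb
      rw [Set.Finite.mem_toFinset] at hb
      exact (d.label_of_mem_boxesBetween hb).1),
  by
    intro b hb
    have hb : b ∈ d.boxesBetween_finite.toFinset := hb
    rw [Set.Finite.mem_toFinset] at hb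
    exact (d.label_of_mem_boxesBetween hb).2⟩

theorem mem_shape (d : PlanarDiagram n) (b : ℤ × ℤ) :
    b ∈ d.shape.1.boxes ↔ b ∈ boxesBetween d.northPath d.southPath :=
  Set.Finite.mem_toFinset _

/-- The arc of a left end in column `k` crosses the next vertical line. This recovers the northern
step when the following diagonal is empty. -/
theorem northStep_eq_zero_of_crossing (d : PlanarDiagram n) {k : ℕ} (h : d.crossing (k + 1) = 0) :
    d.northStep k = 0 := by
  by_cases hk : k < n
  · have h1 := northStep_coe d ⟨k, hk⟩
    simp only at h1
    rw [h1, if_neg]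
    have h2 := (d.crossing_eq_zero_iff (k + 1)).1 h (Sum.inl ⟨k, hk⟩) (Nat.lt_succ_self k)
    rw [Fin.lt_def]
    show ¬ k < ((d.partner (Sum.inl ⟨k, hk⟩)).col : ℕ)
    omega
  · exact northStep_of_le _ (by omega)

/-- A diagram is determined by the BJS-equivalence class of its shape. -/
theorem eq_of_bjsEquiv {d e : PlanarDiagram n} (h : BJSEquiv d.shape.1 e.shape.1) : d = e := by
  have len := h.length_diagonal d.mem_shape e.mem_shape d.southPath_le_northPath
    e.southPath_le_northPath
  have key : ∀ k, d.northStep k = e.northStep k ∧ d.southStep k = e.southStep k := by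
    intro k
    have l0 := len k
    have l1 := len (k + 1)
    have n0 := d.southPath_le_northPath k
    have n1 := d.southPath_le_northPath (k + 1)
    have s1 := fun h0 h1 => h.step_le d.mem_shape e.mem_shape d.isLatticePath_northPath
      e.isLatticePath_northPath d.southPath_le_northPath e.southPath_le_northPath
      (k := k) h0 h1
    have s2 := fun h0 h1 => h.symm.step_le e.mem_shape d.mem_shape e.isLatticePath_northPath
      d.isLatticePath_northPath e.southPath_le_northPath d.southPath_le_northPath
      (k := k) h0 h1
    -- If diagonals `k` and `k + 1` are nonempty, `s1` and `s2` give equal northern steps. If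
    -- diagonal `k + 1` is empty, both northern steps are 0. If only diagonal `k` is empty, the
    -- growth in length forces a northern step 1. The lengths then give the southern steps.
    have c1 := fun h => d.northStep_eq_zero_of_crossing (k := k) h
    have c2 := fun h => e.northStep_eq_zero_of_crossing (k := k) h
    rw [crossing_eq] at c1 c2
    push_cast at c1 c2
    simp only [northPath_natCast_succ, southPath_natCast_succ] at *
    have := d.northStep_mem k
    have := e.northStep_mem k
    have := d.southStep_mem k
    have := e.southStep_mem k
    omega
  exact ext_steps (fun k => (key k).1) (fun k => (key k).2)

/-- Reading the labels of a skew shape along a linear extension of the product order gives a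
reduced expression of a diagram with an equivalent shape. -/
theorem exists_isReducedExpression (S : BoundedSkewShape n) {l : List (ℤ × ℤ)}
    (hmem : ∀ b, b ∈ l ↔ b ∈ S.1.boxes) (hl : l.Pairwise fun x y => ¬ y ≤ x) :
    ∃ d : PlanarDiagram n, IsReducedExpression (labelWord l) d ∧ BJSEquiv S.1 d.shape.1 := by
  obtain ⟨p, q, hp, hq, hqp, hpq⟩ := exists_latticePaths S.1.boxes
    (fun x hx y z hz hxy hyz => S.1.convex hx hz hxy hyz)
  obtain ⟨d, hd1, hd2, hd3, hd4⟩ := exists_wordProduct l p q (nodup_of_pairwise_not_ge hl) hl hp hq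
    hqp (fun b => (hmem b).trans (hpq b))
    (fun b hb => ⟨S.1.label_pos b ((hmem b).1 hb), S.2 b ((hmem b).1 hb)⟩)
  exact ⟨d, isReducedExpression_of_count hd1 hd4, BJSEquiv.of_latticePaths hpq d.mem_shape hd2 hd3⟩

/-- The word read from the shape of `d` is a reduced expression of some diagram with an equivalent
shape, and that diagram can only be `d`. -/
theorem isReducedExpression_labelWord (d : PlanarDiagram n) {l : List (ℤ × ℤ)}
    (hmem : ∀ b, b ∈ l ↔ b ∈ d.shape.1.boxes) (hl : l.Pairwise fun x y => ¬ y ≤ x) :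
    IsReducedExpression (labelWord l) d := by
  obtain ⟨e, he, h⟩ := exists_isReducedExpression d.shape hmem hl
  rwa [← eq_of_bjsEquiv h] at he

/-- A word determines its product, so a shape can be recovered, up to equivalence, from the diagram
that its word represents. Uniqueness of normal forms rests on this. -/
theorem bjsEquiv_of_wordProduct {d : PlanarDiagram n} (S : BoundedSkewShape n) {l : List (ℤ × ℤ)}
    (hmem : ∀ b, b ∈ l ↔ b ∈ S.1.boxes) (hl : l.Pairwise fun x y => ¬ y ≤ x)
    (hd : WordProduct (labelWord l) 0 d) : BJSEquiv S.1 d.shape.1 := by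
  obtain ⟨e, he, h⟩ := exists_isReducedExpression S hmem hl
  rwa [← hd.unique he.1] at h

end PlanarDiagram

/-! ### Words of Jones shape are reading words. -/

theorem mem_descRun {j k m : ℕ} : m ∈ descRun j k ↔ k ≤ m ∧ m ≤ j := by
  rw [descRun, List.mem_reverse, List.mem_range'_1]
  omega

theorem mem_ascRun {j k m : ℕ} : m ∈ ascRun k j ↔ k ≤ m ∧ m ≤ j := by
  rw [ascRun, List.mem_range'_1]
  omega

theorem pairwise_descRun (j k : ℕ) : (descRun j k).Pairwise (· > ·) := by
  rw [descRun, List.pairwise_reverse]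
  exact List.pairwise_lt_range'

theorem pairwise_ascRun (k j : ℕ) : (ascRun k j).Pairwise (· < ·) := List.pairwise_lt_range'

/-- The boxes in given rows with labels in given intervals, row by row. -/
theorem exists_rowList_of_rows (L : List (ℤ × ℕ × ℕ)) (hL : L.Pairwise fun s t => s.1 < t.1) :
    ∃ l : List (ℤ × ℤ), (∀ b, b ∈ l ↔ ∃ t ∈ L, b.1 = t.1 ∧ (t.2.2 : ℤ) ≤ boxLabel b ∧
      boxLabel b ≤ t.2.1) ∧ l.Pairwise RowLT ∧
      labelWord l = (L.map Prod.snd).flatMap fun p => descRun p.1 p.2 := by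
  refine ⟨L.flatMap fun t => (descRun t.2.1 t.2.2).map fun m : ℕ => (t.1, t.1 - m), ?_, ?_, ?_⟩
  · rintro ⟨x, y⟩
    simp only [List.mem_flatMap, List.mem_map, mem_descRun, Prod.mk.injEq, boxLabel]
    refine exists_congr fun t => and_congr_right fun _ => ?_
    constructor
    · rintro ⟨m, hm, rfl, rfl⟩; omega
    · rintro ⟨rfl, h⟩; exact ⟨(t.1 - y).toNat, by omega, rfl, by omega⟩
  · rw [List.pairwise_flatMap]
    constructor
    · intro t _
      rw [List.pairwise_map]
      refine (pairwise_descRun _ _).imp fun {a b} h => Or.inr ⟨rfl, ?_⟩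
      simp only
      omega
    · refine hL.imp fun {s t} hst x hx y hy => Or.inl ?_
      simp only [List.mem_map] at hx hy
      obtain ⟨m, _, rfl⟩ := hx
      obtain ⟨m', _, rfl⟩ := hy
      exact hst
  · rw [labelWord, List.map_flatMap, List.flatMap_map]
    congr 1
    funext t
    rw [List.map_map]
    refine (List.map_congr_left fun m _ => ?_).trans (List.map_id _)
    simp [boxLabel]

/-- The boxes in given columns with labels in given intervals, column by column. -/
theorem exists_colList_of_cols (L : List (ℤ × ℕ × ℕ)) (hL : L.Pairwise fun s t => s.1 < t.1) :
    ∃ l : List (ℤ × ℤ), (∀ b, b ∈ l ↔ ∃ t ∈ L, b.2 = t.1 ∧ (t.2.1 : ℤ) ≤ boxLabel b ∧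
      boxLabel b ≤ t.2.2) ∧ l.Pairwise ColLT ∧
      labelWord l = (L.map Prod.snd).flatMap fun p => ascRun p.1 p.2 := by
  refine ⟨L.flatMap fun t => (ascRun t.2.1 t.2.2).map fun m : ℕ => (t.1 + m, t.1), ?_, ?_, ?_⟩
  · rintro ⟨x, y⟩
    simp only [List.mem_flatMap, List.mem_map, mem_ascRun, Prod.mk.injEq, boxLabel]
    refine exists_congr fun t => and_congr_right fun _ => ?_
    constructor
    · rintro ⟨m, hm, rfl, rfl⟩; omega
    · rintro ⟨rfl, h⟩; exact ⟨(x - t.1).toNat, by omega, by omega, rfl⟩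
  · rw [List.pairwise_flatMap]
    constructor
    · intro t _
      rw [List.pairwise_map]
      refine (pairwise_ascRun _ _).imp fun {a b} h => Or.inr ⟨rfl, ?_⟩
      simp only
      omega
    · refine hL.imp fun {s t} hst x hx y hy => Or.inl ?_
      simp only [List.mem_map] at hx hy
      obtain ⟨m, _, rfl⟩ := hx
      obtain ⟨m', _, rfl⟩ := hy
      exact hst
  · rw [labelWord, List.map_flatMap, List.flatMap_map]
    congr 1
    funext t
    rw [List.map_map]
    refine (List.map_congr_left fun m _ => ?_).trans (List.map_id _)
    simp [boxLabel]

/-- A nonempty set of boxes has boxes of least and greatest label. -/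
theorem exists_extreme_labels (S : LabeledSkewShape) {A : Finset (ℤ × ℤ)} (hA : A ⊆ S.boxes)
    (hne : A.Nonempty) : ∃ j k : ℕ, (∀ b ∈ A, (k : ℤ) ≤ boxLabel b ∧ boxLabel b ≤ j) ∧
      (∃ b ∈ A, boxLabel b = j) ∧ ∃ b ∈ A, boxLabel b = k := by
  obtain ⟨x, hx, hmax⟩ := A.exists_max_image boxLabel hne
  obtain ⟨y, hy, hmin⟩ := A.exists_min_image boxLabel hne
  have := S.label_pos x (hA hx)
  have := S.label_pos y (hA hy)
  refine ⟨(boxLabel x).toNat, (boxLabel y).toNat, fun b hb => ?_, ⟨x, hx, by omega⟩,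
    ⟨y, hy, by omega⟩⟩
  have := hmax b hb
  have := hmin b hb
  omega

/-- The row reading word of a labeled skew shape has Jones shape. -/
theorem hasJonesShape_rowWord {n : ℕ} (S : BoundedSkewShape n) : HasJonesShape n S.1.rowWord := by
  have hrow : ∀ r : ℤ, ∃ j k : ℕ, r ∈ S.1.boxes.image Prod.fst →
      ((∀ y, (r, y) ∈ S.1.boxes → (k : ℤ) ≤ r - y ∧ r - y ≤ j) ∧
        (r, r - j) ∈ S.1.boxes ∧ (r, r - k) ∈ S.1.boxes) := by
    intro r
    by_cases hr : r ∈ S.1.boxes.image Prod.fst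
    swap
    · exact ⟨0, 0, fun h => absurd h hr⟩
    obtain ⟨b, hb, hbr⟩ := Finset.mem_image.1 hr
    obtain ⟨j, k, h1, ⟨⟨x1, x2⟩, hx, hxj⟩, ⟨⟨y1, y2⟩, hy, hyk⟩⟩ := exists_extreme_labels S.1
      (Finset.filter_subset (fun b => b.1 = r) S.1.boxes) ⟨b, Finset.mem_filter.2 ⟨hb, hbr⟩⟩
    refine ⟨j, k, fun _ => ⟨fun y hy => h1 (r, y) (Finset.mem_filter.2 ⟨hy, rfl⟩), ?_, ?_⟩⟩
    · rw [Finset.mem_filter] at hx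
      obtain ⟨hx, rfl⟩ := hx
      have : x1 - (j : ℤ) = x2 := by simp only [boxLabel] at hxj; omega
      simp only
      rwa [this]
    · rw [Finset.mem_filter] at hy
      obtain ⟨hy, rfl⟩ := hy
      have : y1 - (k : ℤ) = y2 := by simp only [boxLabel] at hyk; omega
      simp only
      rwa [this]
  choose J K hJK using hrow
  let R := (S.1.boxes.image Prod.fst).sort (· ≤ ·)
  have hR : R.Pairwise (· < ·) := (Finset.sortedLT_sort _).pairwise
  have hRm : ∀ r, r ∈ R ↔ r ∈ S.1.boxes.image Prod.fst := fun r => Finset.mem_sort _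
  obtain ⟨l, hl1, hl2, hl3⟩ := exists_rowList_of_rows (R.map fun r => (r, J r, K r))
    (by rw [List.pairwise_map]; exact hR)
  have hmem : ∀ b, b ∈ l ↔ b ∈ S.1.boxes := by
    rintro ⟨x, y⟩
    simp only [hl1, List.mem_map, exists_exists_and_eq_and, boxLabel]
    constructor
    · rintro ⟨r, hr, rfl, h⟩
      obtain ⟨_, h2, h3⟩ := hJK x ((hRm x).1 hr)
      exact S.1.convex h2 h3 (by rw [Prod.mk_le_mk]; omega) (by rw [Prod.mk_le_mk]; omega)
    · intro h
      have hx : x ∈ S.1.boxes.image Prod.fst := Finset.mem_image.2 ⟨_, h, rfl⟩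
      exact ⟨x, (hRm x).2 hx, rfl, (hJK x hx).1 y h⟩
  rw [S.1.rowWord_eq hmem hl2, hl3]
  refine ⟨_, rfl, ?_, ?_⟩
  · intro t ht
    simp only [List.mem_map, exists_exists_and_eq_and] at ht
    obtain ⟨r, hr, rfl⟩ := ht
    obtain ⟨h1, h2, h3⟩ := hJK r ((hRm r).1 hr)
    have := S.1.label_pos _ h2
    have := S.1.label_pos _ h3
    have := S.2 _ h2
    have := S.2 _ h3
    have := h1 _ h2
    simp only [boxLabel] at *
    omega
  · rw [List.map_map, List.pairwise_map]
    refine hR.imp_of_mem fun {r s} hr hs hrs => ?_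
    obtain ⟨r1, r2, r3⟩ := hJK r ((hRm r).1 hr)
    obtain ⟨s1, s2, s3⟩ := hJK s ((hRm s).1 hs)
    simp only [Function.comp_apply]
    constructor
    · by_contra hc
      have := s1 (r - J r) (S.1.convex r2 s2 (by rw [Prod.mk_le_mk]; omega)
        (by rw [Prod.mk_le_mk]; omega))
      omega
    · by_contra hc
      have := r1 (s - K s) (S.1.convex r3 s3 (by rw [Prod.mk_le_mk]; omega)
        (by rw [Prod.mk_le_mk]; omega))
      omega

/-- The column reading word of a labeled skew shape has dual Jones shape. -/
theorem hasDualJonesShape_colWord {n : ℕ} (S : BoundedSkewShape n) :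
    HasDualJonesShape n S.1.colWord := by
  have hcol : ∀ c : ℤ, ∃ j k : ℕ, c ∈ S.1.boxes.image Prod.snd →
      ((∀ x, (x, c) ∈ S.1.boxes → (k : ℤ) ≤ x - c ∧ x - c ≤ j) ∧
        (c + j, c) ∈ S.1.boxes ∧ (c + k, c) ∈ S.1.boxes) := by
    intro c
    by_cases hc : c ∈ S.1.boxes.image Prod.snd
    swap
    · exact ⟨0, 0, fun h => absurd h hc⟩
    obtain ⟨b, hb, hbc⟩ := Finset.mem_image.1 hc
    obtain ⟨j, k, h1, ⟨⟨x1, x2⟩, hx, hxj⟩, ⟨⟨y1, y2⟩, hy, hyk⟩⟩ := exists_extreme_labels S.1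
      (Finset.filter_subset (fun b => b.2 = c) S.1.boxes) ⟨b, Finset.mem_filter.2 ⟨hb, hbc⟩⟩
    refine ⟨j, k, fun _ => ⟨fun x hx => h1 (x, c) (Finset.mem_filter.2 ⟨hx, rfl⟩), ?_, ?_⟩⟩
    · rw [Finset.mem_filter] at hx
      obtain ⟨hx, rfl⟩ := hx
      have : x2 + (j : ℤ) = x1 := by simp only [boxLabel] at hxj; omega
      simp only
      rwa [this]
    · rw [Finset.mem_filter] at hy
      obtain ⟨hy, rfl⟩ := hy
      have : y2 + (k : ℤ) = y1 := by simp only [boxLabel] at hyk; omega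
      simp only
      rwa [this]
  choose J K hJK using hcol
  let R := (S.1.boxes.image Prod.snd).sort (· ≤ ·)
  have hR : R.Pairwise (· < ·) := (Finset.sortedLT_sort _).pairwise
  have hRm : ∀ r, r ∈ R ↔ r ∈ S.1.boxes.image Prod.snd := fun r => Finset.mem_sort _
  obtain ⟨l, hl1, hl2, hl3⟩ := exists_colList_of_cols (R.map fun r => (r, K r, J r))
    (by rw [List.pairwise_map]; exact hR)
  have hmem : ∀ b, b ∈ l ↔ b ∈ S.1.boxes := by
    rintro ⟨x, y⟩
    simp only [hl1, List.mem_map, exists_exists_and_eq_and, boxLabel]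
    constructor
    · rintro ⟨r, hr, rfl, h⟩
      obtain ⟨_, h2, h3⟩ := hJK y ((hRm y).1 hr)
      exact S.1.convex h3 h2 (by rw [Prod.mk_le_mk]; omega) (by rw [Prod.mk_le_mk]; omega)
    · intro h
      have hy : y ∈ S.1.boxes.image Prod.snd := Finset.mem_image.2 ⟨_, h, rfl⟩
      exact ⟨y, (hRm y).2 hy, rfl, (hJK y hy).1 x h⟩
  rw [S.1.colWord_eq hmem hl2, hl3]
  refine ⟨_, rfl, ?_, ?_⟩
  · intro t ht
    simp only [List.mem_map, exists_exists_and_eq_and] at ht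
    obtain ⟨r, hr, rfl⟩ := ht
    obtain ⟨h1, h2, h3⟩ := hJK r ((hRm r).1 hr)
    have := S.1.label_pos _ h2
    have := S.1.label_pos _ h3
    have := S.2 _ h2
    have := S.2 _ h3
    have := h1 _ h2
    simp only [boxLabel] at *
    omega
  · rw [List.map_map, List.pairwise_map]
    refine hR.imp_of_mem fun {r s} hr hs hrs => ?_
    obtain ⟨r1, r2, r3⟩ := hJK r ((hRm r).1 hr)
    obtain ⟨s1, s2, s3⟩ := hJK s ((hRm s).1 hs)
    simp only [Function.comp_apply]
    constructor
    · by_contra hc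
      have := s1 (r + K r) (S.1.convex r3 s3 (by rw [Prod.mk_le_mk]; omega)
        (by rw [Prod.mk_le_mk]; omega))
      omega
    · by_contra hc
      have := r1 (s + J s) (S.1.convex r2 s2 (by rw [Prod.mk_le_mk]; omega)
        (by rw [Prod.mk_le_mk]; omega))
      omega

/-- The indexed list of runs of a word in (dual) Jones shape. -/
def indexedRuns (jk : List (ℕ × ℕ)) : List (ℤ × ℕ × ℕ) := jk.zipIdx.map fun t => ((t.2 : ℤ), t.1)

theorem mem_indexedRuns {jk : List (ℕ × ℕ)} {t : ℤ × ℕ × ℕ} :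
    t ∈ indexedRuns jk ↔ ∃ (m : ℕ) (hm : m < jk.length), t.1 = m ∧ t.2 = jk[m] := by
  simp only [indexedRuns, List.mem_map, List.mem_zipIdx_iff_getElem?, List.getElem?_eq_some_iff]
  constructor
  · rintro ⟨⟨p, m⟩, ⟨hm, h⟩, rfl⟩; exact ⟨m, hm, rfl, h.symm⟩
  · rintro ⟨m, hm, h1, h2⟩; exact ⟨(t.2, m), ⟨hm, h2.symm⟩, Prod.ext h1.symm rfl⟩

theorem pairwise_indexedRuns (jk : List (ℕ × ℕ)) :
    (indexedRuns jk).Pairwise fun s t => s.1 < t.1 := by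
  have h : ((jk.zipIdx).map Prod.snd).Pairwise (· < ·) := by
    rw [List.zipIdx_map_snd]
    exact List.pairwise_lt_range'
  rw [indexedRuns, List.pairwise_map]
  rw [List.pairwise_map] at h
  exact h.imp fun h => Int.ofNat_lt.2 h

theorem map_snd_indexedRuns (jk : List (ℕ × ℕ)) : (indexedRuns jk).map Prod.snd = jk := by
  rw [indexedRuns, List.map_map]
  exact List.zipIdx_map_fst 0 jk

/-- A word of Jones shape is the row reading word of a labeled skew shape. -/
theorem HasJonesShape.exists_rowWord_eq {n : ℕ} {w : List ℕ} (h : HasJonesShape n w) :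
    ∃ S : BoundedSkewShape n, S.1.rowWord = w := by
  obtain ⟨jk, rfl, hb, hp⟩ := h
  obtain ⟨l, hl1, hl2, hl3⟩ := exists_rowList_of_rows _ (pairwise_indexedRuns jk)
  rw [map_snd_indexedRuns] at hl3
  -- Run `m` is placed in row `m`. Strictly increasing integers grow by at least 1 per row, so both
  -- ends of the rows move weakly west towards the south, which gives convexity.
  have grow : ∀ (t m : ℕ) (hm : m + t < jk.length),
      (jk[m]).1 + t ≤ (jk[m + t]).1 ∧ (jk[m]).2 + t ≤ (jk[m + t]).2 := by
    intro t
    induction t with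
    | zero => intro m hm; exact ⟨le_rfl, le_rfl⟩
    | succ t ih =>
      intro m hm
      have h1 := ih m (by omega)
      have h2 := List.pairwise_iff_getElem.1 hp (m + t) (m + (t + 1)) (by omega) hm (by omega)
      omega
  have hmem : ∀ x y : ℤ, (x, y) ∈ l ↔ ∃ (m : ℕ) (hm : m < jk.length), x = m ∧
      ((jk[m]).2 : ℤ) ≤ x - y ∧ x - y ≤ (jk[m]).1 := by
    intro x y
    rw [hl1]
    simp only [mem_indexedRuns, boxLabel]
    constructor
    · rintro ⟨⟨r, p⟩, ⟨m, hm, rfl, rfl⟩, rfl, h⟩; exact ⟨m, hm, rfl, h⟩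
    · rintro ⟨m, hm, rfl, h⟩; exact ⟨(m, jk[m]), ⟨m, hm, rfl, rfl⟩, rfl, h⟩
  have hlab : ∀ b ∈ l, 0 < boxLabel b ∧ boxLabel b < n := by
    rintro ⟨x, y⟩ h
    obtain ⟨m, hm, h1, h2⟩ := (hmem x y).1 h
    have := hb jk[m] (List.getElem_mem hm)
    simp only [boxLabel]
    omega
  refine ⟨⟨LabeledSkewShape.ofConvex l.toFinset ?_ ?_, ?_⟩, ?_⟩
  · rintro ⟨x1, x2⟩ hx ⟨y1, y2⟩ ⟨z1, z2⟩ hz hxy hyz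
    rw [List.mem_toFinset, hmem] at *
    rw [Prod.mk_le_mk] at hxy hyz
    obtain ⟨m, hm, rfl, hm1⟩ := hx
    obtain ⟨m', hm', rfl, hm1'⟩ := hz
    lift y1 to ℕ using by omega
    obtain ⟨s, rfl⟩ : ∃ s, y1 = m + s := ⟨y1 - m, by omega⟩
    obtain ⟨t, rfl⟩ : ∃ t, m' = m + s + t := ⟨m' - (m + s), by omega⟩
    have g1 := grow s m (by omega)
    have g2 := grow t (m + s) (by omega)
    exact ⟨m + s, by omega, rfl, by omega⟩
  · intro b hb
    exact (hlab b (List.mem_toFinset.1 hb)).1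
  · intro b hb
    exact (hlab b (List.mem_toFinset.1 hb)).2
  · rw [LabeledSkewShape.rowWord_eq (fun b => List.mem_toFinset.symm) hl2, hl3]

/-- A word of dual Jones shape is the column reading word of a labeled skew shape. -/
theorem HasDualJonesShape.exists_colWord_eq {n : ℕ} {w : List ℕ} (h : HasDualJonesShape n w) :
    ∃ S : BoundedSkewShape n, S.1.colWord = w := by
  obtain ⟨jk, rfl, hb, hp⟩ := h
  obtain ⟨l, hl1, hl2, hl3⟩ := exists_colList_of_cols _ (pairwise_indexedRuns jk)
  rw [map_snd_indexedRuns] at hl3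
  -- Run `m` is placed in column `m`; both ends of the columns move weakly north towards the east.
  have grow : ∀ (t m : ℕ) (hm : m + t < jk.length),
      (jk[m + t]).1 + t ≤ (jk[m]).1 ∧ (jk[m + t]).2 + t ≤ (jk[m]).2 := by
    intro t
    induction t with
    | zero => intro m hm; exact ⟨le_rfl, le_rfl⟩
    | succ t ih =>
      intro m hm
      have h1 := ih m (by omega)
      have h2 := List.pairwise_iff_getElem.1 hp (m + t) (m + (t + 1)) (by omega) hm (by omega)
      omega
  have hmem : ∀ x y : ℤ, (x, y) ∈ l ↔ ∃ (m : ℕ) (hm : m < jk.length), y = m ∧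
      ((jk[m]).1 : ℤ) ≤ x - y ∧ x - y ≤ (jk[m]).2 := by
    intro x y
    rw [hl1]
    simp only [mem_indexedRuns, boxLabel]
    constructor
    · rintro ⟨⟨r, p⟩, ⟨m, hm, rfl, rfl⟩, rfl, h⟩; exact ⟨m, hm, rfl, h⟩
    · rintro ⟨m, hm, rfl, h⟩; exact ⟨(m, jk[m]), ⟨m, hm, rfl, rfl⟩, rfl, h⟩
  have hlab : ∀ b ∈ l, 0 < boxLabel b ∧ boxLabel b < n := by
    rintro ⟨x, y⟩ h
    obtain ⟨m, hm, h1, h2⟩ := (hmem x y).1 h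
    have := hb jk[m] (List.getElem_mem hm)
    simp only [boxLabel]
    omega
  refine ⟨⟨LabeledSkewShape.ofConvex l.toFinset ?_ ?_, ?_⟩, ?_⟩
  · rintro ⟨x1, x2⟩ hx ⟨y1, y2⟩ ⟨z1, z2⟩ hz hxy hyz
    rw [List.mem_toFinset, hmem] at *
    rw [Prod.mk_le_mk] at hxy hyz
    obtain ⟨m, hm, rfl, hm1⟩ := hx
    obtain ⟨m', hm', rfl, hm1'⟩ := hz
    lift y2 to ℕ using by omega
    obtain ⟨s, rfl⟩ : ∃ s, y2 = m + s := ⟨y2 - m, by omega⟩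
    obtain ⟨t, rfl⟩ : ∃ t, m' = m + s + t := ⟨m' - (m + s), by omega⟩
    have g1 := grow s m (by omega)
    have g2 := grow t (m + s) (by omega)
    exact ⟨m + s, by omega, rfl, by omega⟩
  · intro b hb
    exact (hlab b (List.mem_toFinset.1 hb)).1
  · intro b hb
    exact (hlab b (List.mem_toFinset.1 hb)).2
  · rw [LabeledSkewShape.colWord_eq (fun b => List.mem_toFinset.symm) hl2, hl3]

/-! ### Bowman's path and the boxes it encloses. -/

theorem pathSegments_map_range_append (m : ℕ) (c : ℕ → Compass) (pos : ℕ → ℤ × ℤ)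
    (l : List Compass) (h : ∀ k < m, pos (k + 1) = pos k + (c k).step) :
    pathSegments (pos 0) ((List.range m).map c ++ l) =
      (List.range m).map (fun k => s(pos k, pos (k + 1))) ++ pathSegments (pos m) l := by
  induction m generalizing c pos with
  | zero => rfl
  | succ m ih =>
    have := ih (fun k => c (k + 1)) (fun k => pos (k + 1)) (fun k hk => h (k + 1) (by omega))
    simp only [List.range_succ_eq_map, List.map_cons, List.map_map, List.cons_append, pathSegments]
    rw [← h 0 (by omega)]
    exact congrArg _ this

/-- The lattice path `p` traverses the vertical segment from `(x - 1, y)` to `(x, y)`. -/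
def OnPath (p : ℤ → ℤ) (x y : ℤ) : Prop := p (x - 1 - y) = -y ∧ p (x - y) = -y

/-- The segment is the common side of the boxes `(x, y)` and `(x, y + 1)`. A lattice path contains
it exactly when the eastern box is on its southeastern side and the western box is not. -/
theorem onPath_iff {p : ℤ → ℤ} (hp : IsLatticePath p) (x y : ℤ) :
    OnPath p x y ↔ -(y + 1) < p (x - (y + 1)) ∧ ¬ -y < p (x - y) := by
  have := hp (x - 1 - y)
  rw [show x - 1 - y + 1 = x - y by ring] at this
  rw [OnPath, show x - (y + 1) = x - 1 - y by ring]
  omega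

theorem segment_eq_iff {p : ℤ → ℤ} (x y k : ℤ) :
    s((x - 1, y), (x, y)) = s((k - p k, -p k), (k + 1 - p (k + 1), -p (k + 1))) ↔
      OnPath p x y ∧ k = x - 1 - y := by
  simp only [Sym2.eq_iff, Prod.mk.injEq, OnPath]
  constructor
  · rintro (h | h)
    · obtain rfl : k = x - 1 - y := by omega
      rw [show x - 1 - y + 1 = x - y by ring] at h
      omega
    · omega
  · rintro ⟨h, rfl⟩
    left
    rw [show x - 1 - y + 1 = x - y by ring]
    omega

/-- The difference of the coordinates grows by one with each step, so a lattice path never repeats a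
segment. -/
theorem segment_injective (p : ℤ → ℤ) : Function.Injective fun k : ℤ =>
    (s((k - p k, -p k), (k + 1 - p (k + 1), -p (k + 1))) : Sym2 (ℤ × ℤ)) := by
  intro k j h
  simp only [Sym2.eq_iff, Prod.mk.injEq] at h
  omega

namespace PlanarDiagram

variable {n : ℕ}

theorem map_xi_north (d : PlanarDiagram n) : (List.finRange n).map (fun k => xi d (Sum.inl k)) =
    (List.range n).map (fun k => if d.northStep k = 1 then Compass.W else Compass.S) := by
  rw [← List.map_coe_finRange_eq_range, List.map_map]
  refine List.map_congr_left fun k _ => ?_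
  rw [Function.comp_apply, northStep_coe, xi]
  split_ifs <;> first | rfl | simp_all

theorem map_xi_south (d : PlanarDiagram n) :
    (List.finRange n).reverse.map (fun k => xi d (Sum.inr k)) =
    (List.range n).map
      (fun m => if d.southStep (n - 1 - m) = 1 then Compass.E else Compass.N) := by
  rw [← List.map_coe_finRange_eq_range, List.map_map, List.finRange_reverse, List.map_map]
  refine List.map_congr_left fun k _ => ?_
  have h : n - 1 - (k : ℕ) = (Fin.rev k : ℕ) := by rw [Fin.val_rev]; omega
  rw [Function.comp_apply, Function.comp_apply, h, southStep_coe, xi]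
  split_ifs <;> first | rfl | simp_all

theorem pathSegments_xiVector (d : PlanarDiagram n) :
    pathSegments (0, 0) (xiVector d) =
      (List.range n).map (fun k : ℕ => s(((k : ℤ) - d.northPath k, -d.northPath k),
        ((k : ℤ) + 1 - d.northPath (k + 1), -d.northPath (k + 1)))) ++
      (List.range n).map (fun m : ℕ =>
        s(((n : ℤ) - 1 - m - d.southPath (n - 1 - m), -d.southPath (n - 1 - m)),
          ((n : ℤ) - 1 - m + 1 - d.southPath (n - 1 - m + 1), -d.southPath (n - 1 - m + 1)))) := by
  have h1 := pathSegments_map_range_append n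
    (fun k => if d.northStep k = 1 then Compass.W else Compass.S)
    (fun k => ((k : ℤ) - d.northPath k, -d.northPath k))
    ((List.finRange n).reverse.map (fun k => xi d (Sum.inr k)))
    (by
      intro k _
      push_cast
      rw [northPath_natCast_succ]
      rcases d.northStep_mem k with h | h <;> rw [h] <;>
        simp only [Compass.step, if_true, zero_ne_one, if_false, Prod.mk_add_mk, Prod.mk.injEq] <;>
        omega)
  have h2 := pathSegments_map_range_append n
    (fun m => if d.southStep (n - 1 - m) = 1 then Compass.E else Compass.N)
    -- The second half of the walk runs along the south path backwards, starting at `n`, where the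
    -- two paths meet.
    (fun m => ((n : ℤ) - m - d.southPath (n - m), -d.southPath (n - m))) []
    (by
      intro m hm
      have e1 : (n : ℤ) - m = ((n - 1 - m : ℕ) : ℤ) + 1 := by omega
      have e2 : (n : ℤ) - (m + 1 : ℕ) = ((n - 1 - m : ℕ) : ℤ) := by omega
      rw [e1, e2, southPath_natCast_succ]
      rcases d.southStep_mem (n - 1 - m) with h | h <;> rw [h] <;>
        simp only [Compass.step, if_true, zero_ne_one, if_false, Prod.mk_add_mk, Prod.mk.injEq] <;>
        omega)
  rw [List.append_nil] at h2
  simp only [Nat.cast_zero, sub_zero, pathSegments, List.append_nil,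
    d.southPath_eq_northPath (Or.inr le_rfl)] at h2
  simp only [Nat.cast_zero, northPath_of_nonpos _ le_rfl, sub_zero, neg_zero, map_xi_south] at h1
  rw [xiVector, map_xi_north, map_xi_south, h1, h2]
  congr 1
  refine List.map_congr_left fun m _ => ?_
  rw [Sym2.eq_swap]
  push_cast
  rw [show (n : ℤ) - 1 - m + 1 = n - m by ring, show (n : ℤ) - 1 - m = n - (m + 1) by ring]

-- Each path traverses a segment at most once, so the total count is 1 iff exactly one of the two
-- paths contains it.
open scoped Classical in
theorem mem_keptSegments (d : PlanarDiagram n) (x y : ℤ) :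
    s((x - 1, y), (x, y)) ∈ keptSegments d ↔
      ¬ (OnPath d.northPath x y ↔ OnPath d.southPath x y) := by
  have hcount : ∀ (f : ℕ → Sym2 (ℤ × ℤ)) (P : Prop), Function.Injective f →
      ((∃ k, k < n ∧ f k = s((x - 1, y), (x, y))) ↔ P) →
      ((List.range n).map f).count s((x - 1, y), (x, y)) = if P then 1 else 0 := by
    intro f P hf hP
    split_ifs with h
    · refine List.count_eq_one_of_mem (List.nodup_range.map hf) ?_
      simpa using hP.2 h
    · refine List.count_eq_zero_of_not_mem fun hm => h (hP.1 ?_)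
      simpa using hm
  -- Both paths are extended to all of `ℤ`, but the extensions coincide and do not affect the
  -- comparison.
  have hout : ¬ (0 ≤ x - 1 - y ∧ x - 1 - y < n) →
      (OnPath d.northPath x y ↔ OnPath d.southPath x y) := by
    intro h
    rw [OnPath, OnPath, d.southPath_eq_northPath (by omega), d.southPath_eq_northPath (by omega)]
  have e : s((x - 1, y), (x, y)) ∈ keptSegments d ↔
    (pathSegments (0, 0) (xiVector d)).count s((x - 1, y), (x, y)) = 1 := Iff.rfl
  rw [e, pathSegments_xiVector, List.count_append,
    hcount _ (OnPath d.northPath x y ∧ 0 ≤ x - 1 - y ∧ x - 1 - y < n),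
    hcount _ (OnPath d.southPath x y ∧ 0 ≤ x - 1 - y ∧ x - 1 - y < n)]
  · split_ifs <;> simp <;> tauto
  · intro k j h
    have := segment_injective d.southPath h
    omega
  · constructor
    · rintro ⟨m, hm, h⟩
      obtain ⟨h1, h2⟩ := (segment_eq_iff x y _).1 h.symm
      exact ⟨h1, by omega⟩
    · rintro ⟨h1, h2⟩
      refine ⟨((n : ℤ) - 1 - (x - 1 - y)).toNat, by omega, ((segment_eq_iff x y _).2 ⟨h1, ?_⟩).symm⟩
      omega
  · intro k j h
    have := segment_injective d.northPath h
    omega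
  · constructor
    · rintro ⟨m, hm, h⟩
      obtain ⟨h1, h2⟩ := (segment_eq_iff x y _).1 h.symm
      exact ⟨h1, by omega⟩
    · rintro ⟨h1, h2⟩
      refine ⟨(x - 1 - y).toNat, by omega, ((segment_eq_iff x y _).2 ⟨h1, ?_⟩).symm⟩
      omega

theorem northPath_nonneg (d : PlanarDiagram n) (k : ℤ) : 0 ≤ d.northPath k :=
  Finset.sum_nonneg fun j _ => by rcases d.northStep_mem j with h | h <;> omega

theorem southPath_nonneg (d : PlanarDiagram n) (k : ℤ) : 0 ≤ d.southPath k :=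
  Finset.sum_nonneg fun j _ => by rcases d.southStep_mem j with h | h <;> omega

/-- The boxes enclosed by Bowman's path are the boxes between the two lattice paths. -/
theorem enclosedBoxes_eq (d : PlanarDiagram n) :
    enclosedBoxes d = boxesBetween d.northPath d.southPath := by
  ext ⟨x, y⟩
  let A : ℤ → Set ℤ := fun z => {y | z ≤ y ∧ s((x - 1, y), (x, y)) ∈ keptSegments d}
  have hpos : ∀ z, s((x - 1, z), (x, z)) ∈ keptSegments d → z ≤ 0 := by
    intro z hz
    rw [mem_keptSegments] at hz
    by_contra hc
    have h1 := d.northPath_nonneg (x - z)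
    have h2 := d.southPath_nonneg (x - z)
    refine hz ⟨fun h => ?_, fun h => ?_⟩
    · have := h.2; omega
    · have := h.2; omega
  have hfin : ∀ z, (A z).Finite := fun z =>
    (Set.finite_Icc z 0).subset fun u hu => ⟨hu.1, hpos u hu.2⟩
  -- Induction from the east. No kept segment has `y > 0`, so the ray from far east starts outside.
  -- Moving west by one box, a kept segment changes the parity; it also toggles membership in the
  -- region, because exactly one of the two paths is passed.
  have key : ∀ (t : ℕ) (z : ℤ), 1 - (t : ℤ) ≤ z →
      (Odd (A z).ncard ↔ (x, z) ∈ boxesBetween d.northPath d.southPath) := by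
    intro t
    induction t with
    | zero =>
      intro z hz
      have h0 : A z = ∅ := by
        rw [Set.eq_empty_iff_forall_notMem]
        intro u hu
        have := hpos u hu.2
        have := hu.1
        omega
      have := d.southPath_nonneg (x - z)
      rw [h0, Set.ncard_empty, mem_boxesBetween]
      simp only [Nat.not_odd_zero, false_iff]
      omega
    | succ t ih =>
      intro z hz
      have h1 := ih (z + 1) (by push_cast at hz; omega)
      have h2 := d.mem_keptSegments x z
      rw [onPath_iff d.isLatticePath_northPath, onPath_iff d.isLatticePath_southPath] at h2
      have l1 := d.isLatticePath_northPath (x - (z + 1))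
      have l2 := d.isLatticePath_southPath (x - (z + 1))
      have l3 := d.southPath_le_northPath (x - (z + 1))
      have l4 := d.southPath_le_northPath (x - z)
      rw [show x - (z + 1) + 1 = x - z by ring] at l1 l2
      rw [mem_boxesBetween] at h1 ⊢
      simp only at h1 ⊢
      by_cases hk : s((x - 1, z), (x, z)) ∈ keptSegments d
      · have e : A z = insert z (A (z + 1)) := by
          ext u
          simp only [A, Set.mem_ofPred_eq, Set.mem_insert_iff]
          constructor
          · rintro ⟨h3, h4⟩
            rcases h3.eq_or_lt with h5 | h5
            · exact Or.inl h5.symm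
            · exact Or.inr ⟨h5, h4⟩
          · rintro (rfl | ⟨h3, h4⟩)
            · exact ⟨le_rfl, hk⟩
            · exact ⟨by omega, h4⟩
        rw [e, Set.ncard_insert_of_notMem (fun h => by have := h.1; omega) (hfin _),
          Nat.odd_add_one, h1]
        have := not_iff.1 (h2.1 hk)
        omega
      · have e : A z = A (z + 1) := by
          ext u
          simp only [A, Set.mem_ofPred_eq]
          constructor
          · rintro ⟨h3, h4⟩
            rcases h3.eq_or_lt with h5 | h5
            · subst h5; exact absurd h4 hk
            · exact ⟨h5, h4⟩
          · rintro ⟨h3, h4⟩; exact ⟨by omega, h4⟩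
        rw [e, h1]
        have := not_not.1 (mt h2.2 hk)
        omega
  exact key (1 - y).toNat y (by omega)

end PlanarDiagram

theorem theorem6p4 (n : ℕ) :
    ∃ Θ : PlanarDiagram n → BoundedSkewShape n,
      (∀ d : PlanarDiagram n, ((Θ d).1.boxes : Set (ℤ × ℤ)) = enclosedBoxes d) ∧
      Function.Bijective
        (fun d : PlanarDiagram n => (Quotient.mk (bjsSetoid n) (Θ d) : Quotient (bjsSetoid n))) ∧
      (∀ d : PlanarDiagram n,
        (∀ w : List ℕ, IsJonesNormalForm w d ↔ w = (Θ d).1.rowWord) ∧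
        (∀ w : List ℕ, IsDualJonesNormalForm w d ↔ w = (Θ d).1.colWord)) := by
  refine ⟨PlanarDiagram.shape, fun d => ?_, ⟨?_, ?_⟩, fun d => ⟨fun w => ⟨?_, ?_⟩, fun w => ⟨?_, ?_⟩⟩⟩
  · rw [PlanarDiagram.enclosedBoxes_eq]
    ext b
    exact d.mem_shape b
  · intro d e h
    exact PlanarDiagram.eq_of_bjsEquiv (Quotient.exact h)
  · intro c
    induction c using Quotient.inductionOn with | _ S => ?_
    obtain ⟨l, hmem, hl⟩ := S.1.exists_rowList
    obtain ⟨d, -, hd⟩ := PlanarDiagram.exists_isReducedExpression S hmem (hl.imp RowLT.not_ge)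
    exact ⟨d, Quotient.sound hd.symm⟩
  -- Uniqueness: `w` is the row word of some skew shape, which is equivalent to the shape of `d`
  -- because `w` represents `d`, and equivalent shapes have equal row words.
  · rintro ⟨hw, hs⟩
    obtain ⟨S, rfl⟩ := hs.exists_rowWord_eq
    obtain ⟨l, hmem, hl⟩ := S.1.exists_rowList
    have h := hw.1
    rw [S.1.rowWord_eq hmem hl] at h
    exact (PlanarDiagram.bjsEquiv_of_wordProduct S hmem (hl.imp RowLT.not_ge) h).rowWord_eq
  · rintro rfl
    refine ⟨?_, hasJonesShape_rowWord _⟩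
    obtain ⟨l, hmem, hl⟩ := d.shape.1.exists_rowList
    rw [LabeledSkewShape.rowWord_eq hmem hl]
    exact d.isReducedExpression_labelWord hmem (hl.imp RowLT.not_ge)
  · rintro ⟨hw, hs⟩
    obtain ⟨S, rfl⟩ := hs.exists_colWord_eq
    obtain ⟨l, hmem, hl⟩ := S.1.exists_colList
    have h := hw.1
    rw [S.1.colWord_eq hmem hl] at h
    exact (PlanarDiagram.bjsEquiv_of_wordProduct S hmem (hl.imp ColLT.not_ge) h).colWord_eq
  · rintro rfl
    refine ⟨?_, hasDualJonesShape_colWord _⟩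
    obtain ⟨l, hmem, hl⟩ := d.shape.1.exists_colList
    rw [LabeledSkewShape.colWord_eq hmem hl]
    exact d.isReducedExpression_labelWord hmem (hl.imp ColLT.not_ge)
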